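/- **Setting.** Let $\epsilon\in[0,1)$. Put $\Sigma=\mathbb{R}\cup i\mathbb{R}$, $D_\pm=\{\lambda\in\mathbb{C}:\pm\operatorname{Im}(\lambda^2)>0\}$. Let $q(x,t)$ be a smooth complex function on $\mathbb{R}^2$ such that for every $t$ the function $q(\cdot,t)$ decays faster than every power, $q_x(\cdot,t)\in L^1\cap L^3$ and $q_{xx}(\cdot,t)\in L^1$. For fixed $t$, the Jost functions $\Phi^\pm=[\phi_1^\pm,\phi_2^\pm]=(\phi_{ij}^\pm)$ are the solutions of $$\Phi_x=\left(-i\lambda^2\begin{pmatrix}1&0\\0&-1\end{pmatrix}+\lambda\begin{pmatrix}0&q_x\\-q_x^*&0\end{pmatrix}\right)\Phi,$$ $$e^{i\lambda^2x}\phi_1^\pm\to(1,0)^\top,\qquad e^{-i\lambda^2x}\phi_2^\pm\to(0,1)^\top\qquad(x\to\pm\infty),$$ where $\phi_1^-,\phi_2^+$ are taken for $\lambda\in D_+\cup\Sigma$ and $\phi_1^+,\phi_2^-$ for $\lambda\in D_-\cup\Sigma$. The scattering coefficients are $s_{11}=\det[\phi_1^-,\phi_2^+]$ on $D_+\cup\Sigma$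 and $s_{22}=\det[\phi_1^+,\phi_2^-]$ on $D_-\cup\Sigma$ (independent of $x$). It is required that $s_{11}$ and $s_{22}$ do not vanish on $\Sigma$ and have only finitely many zeros, all simple, in $D_+$ and $D_-$ respectively; these sets of zeros are denoted $\Lambda_1\subset D_+$, $\Lambda_2\subset D_-$. The fractional Fokas–Lenells equation is $$\begin{aligned}q_{xt}(x,t)=&-\frac1{4\pi}\int_{\Gamma_+}\frac{|2\lambda^2|^{2\epsilon}}{\lambda^3s_{11}^2(\lambda;t)}\,\partial_x\big((\phi_{11}^-(\lambda;x,t))^2\big)\int_{-\infty}^{\infty}\Big((\phi_{12}^+(\lambda;y,t))^2q_y^*(y,t)-(\phi_{22}^+(\lambda;y,t))^2q_y(y,t)\Big)dy\,d\lambda\\&+\frac1{4\pi}\int_{\Gamma_-}\frac{|2\lambda^2|^{2\epsilon}}{\lambda^3s_{22}^2(\lambda;t)}\,\partial_x\big((\phi_{12}^-(\lambda;x,t))^2\big)\int_{-\infty}^{\infty}\Big((\phi_{11}^+(\lambda;y,t))^2q_y^*(y,t)-(\phi_{21}^+(\lambda;y,t))^2q_y(y,t)\Big)dy\,d\lambda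 .\end{aligned}$$ Here $\Gamma_\pm$ are the contours in $D_\pm$ around the discrete spectrum, drawn in onto $\Sigma$ and onto the zeros: with $K_\pm(\lambda,y)$ denoting the full integrands, $$\int_{\Gamma_\pm}\!\int_{-\infty}^{\infty}K_\pm\,dy\,d\lambda=-\int_\Sigma\int_{-\infty}^{\infty}K_\pm(\lambda,y)\,dy\,d\lambda\;\pm\sum_{a}\int_{-\infty}^{\infty}\Big(\lim_{r\to0+}\oint_{|\lambda-a|=r}K_\pm(\lambda,y)\,d\lambda\Big)dy,$$ where $a$ runs over $\Lambda_1$ for $\Gamma_+$ and over $\Lambda_2$ for $\Gamma_-$, the circles are counterclockwise, and $\Sigma$ is oriented from $\pm i\infty$ to $0$ and from $0$ to $\pm\infty$. A solution is a function $q$ as above for which all these limits and integrals exist (the integrals over $y$ and over each half axis of $\Sigma$ absolutely) and the equation holds at every $(x,t)\in\mathbb{R}^2$. **Proposition.** Let $\xi>0$, $\eta>0$, $\epsilon\in[0,1)$, and let $\nu_{11},\nu_{21}$ be nonzero complex constants. Then $$q^{[1]}(x,t)=\frac{2i\xi\eta\,\nu_{21}^*\,e^{2i\theta_{1I}+\varpi_1}}{(\xi+i\eta)^2(\xi-i\eta)\,\nu_{11}^*}\operatorname{sech}(2\theta_{1R}+\varpi_1),$$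 where, with the principal logarithm, $$\theta_{1R}=2\xi\eta x+2^{2\epsilon-1}\xi\eta(\xi^2+\eta^2)^{2\epsilon-2}t,\qquad \theta_{1I}=-(\xi^2-\eta^2)x+4^{\epsilon-1}(\xi^2-\eta^2)(\xi^2+\eta^2)^{2\epsilon-2}t,$$ $$\varpi_1=\ln\frac{(\xi+i\eta)|\nu_{11}|}{\sqrt{\xi^2+\eta^2}\,|\nu_{21}|},$$ is a solution of the fractional Fokas–Lenells equation. -/

import Mathlib

open Filter Topology MeasureTheory

/-!
Conventions.  The potential is `q : ℝ → ℝ → ℂ`, used as `q x t`; `spec` is the spectral parameter.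
The regions are `D₊ = {Im (spec ^ 2) > 0}` (open first and third quadrants),
`D₋ = {Im (spec ^ 2) < 0}` (open second and fourth quadrants), and
`Σ = {Im (spec ^ 2) = 0}` is the union of the real and the imaginary axis.
-/

namespace FracFL

noncomputable section

/-- Complex hyperbolic secant. -/
def sech (z : ℂ) : ℂ := (Complex.cosh z)⁻¹

/-- The spatial matrix `U = -i spec² σ₃ + spec Q_x`, with `Q = [[0, q], [r, 0]]` and `r = -q^*`;
`w` is the value of `q_x`. -/
def laxU (spec w : ℂ) : Matrix (Fin 2) (Fin 2) ℂ :=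
  (-Complex.I * spec ^ 2) • !![1, 0; 0, -1] + spec • !![0, w; -(starRingEnd ℂ) w, 0]

/-- `phi` is a (vector) solution of `phi_x = U phi` with `q_x = u`. -/
def IsWave (u : ℝ → ℂ) (spec : ℂ) (phi : ℝ → Fin 2 → ℂ) : Prop :=
  ∀ x : ℝ, HasDerivAt phi ((laxU spec (u x)).mulVec (phi x)) x

/-- A choice of the four columns `φ₁⁻, φ₂⁻, φ₁⁺, φ₂⁺` of the wave matrices `Φ^∓`, as functions of
the spectral parameter and of `x`; component `0` is the first entry and `1` the second. -/
structure Columns where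
  /-- the column `φ₁⁻ = (φ₁₁⁻, φ₂₁⁻)` -/
  m1 : ℂ → ℝ → Fin 2 → ℂ
  /-- the column `φ₂⁻ = (φ₁₂⁻, φ₂₂⁻)` -/
  m2 : ℂ → ℝ → Fin 2 → ℂ
  /-- the column `φ₁⁺ = (φ₁₁⁺, φ₂₁⁺)` -/
  p1 : ℂ → ℝ → Fin 2 → ℂ
  /-- the column `φ₂⁺ = (φ₁₂⁺, φ₂₂⁺)` -/
  p2 : ℂ → ℝ → Fin 2 → ℂ

/-- The columns are the Jost functions of the potential derivative `u = q_x`: they solve the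
spatial Lax equation and `Φ^± ∼ exp (-i spec² σ₃ x)` as `x → ±∞`, each column being taken on the
closed region on which it exists.  There these conditions determine it uniquely. -/
structure IsJost (u : ℝ → ℂ) (J : Columns) : Prop where
  m1_wave : ∀ spec : ℂ, 0 ≤ (spec ^ 2).im → IsWave u spec (J.m1 spec)
  m1_lim : ∀ spec : ℂ, 0 ≤ (spec ^ 2).im →
    Tendsto (fun x : ℝ => Complex.exp (Complex.I * spec ^ 2 * x) • J.m1 spec x) atBot
      (𝓝 ![1, 0])
  p2_wave : ∀ spec : ℂ, 0 ≤ (spec ^ 2).im → IsWave u spec (J.p2 spec)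
  p2_lim : ∀ spec : ℂ, 0 ≤ (spec ^ 2).im →
    Tendsto (fun x : ℝ => Complex.exp (-(Complex.I * spec ^ 2 * x)) • J.p2 spec x) atTop
      (𝓝 ![0, 1])
  p1_wave : ∀ spec : ℂ, (spec ^ 2).im ≤ 0 → IsWave u spec (J.p1 spec)
  p1_lim : ∀ spec : ℂ, (spec ^ 2).im ≤ 0 →
    Tendsto (fun x : ℝ => Complex.exp (Complex.I * spec ^ 2 * x) • J.p1 spec x) atTop
      (𝓝 ![1, 0])
  m2_wave : ∀ spec : ℂ, (spec ^ 2).im ≤ 0 → IsWave u spec (J.m2 spec)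
  m2_lim : ∀ spec : ℂ, (spec ^ 2).im ≤ 0 →
    Tendsto (fun x : ℝ => Complex.exp (-(Complex.I * spec ^ 2 * x)) • J.m2 spec x) atBot
      (𝓝 ![0, 1])

/-- The determinant of the matrix with columns `v`, `w`. -/
def colDet (v w : Fin 2 → ℂ) : ℂ := Matrix.det !![v 0, w 0; v 1, w 1]

/-- `s11 = |φ₁⁻, φ₂⁺|` on `D₊ ∪ Σ` and `s22 = |φ₁⁺, φ₂⁻|` on `D₋ ∪ Σ`
(these determinants do not depend on `x`). -/
structure IsScattering (J : Columns) (s11 s22 : ℂ → ℂ) : Prop where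
  s11_eq : ∀ spec : ℂ, 0 ≤ (spec ^ 2).im → ∀ x : ℝ,
    s11 spec = colDet (J.m1 spec x) (J.p2 spec x)
  s22_eq : ∀ spec : ℂ, (spec ^ 2).im ≤ 0 → ∀ x : ℝ,
    s22 spec = colDet (J.p1 spec x) (J.m2 spec x)

/-- `L1` is the set of zeros of `s11` in `D₊`, `L2` the set of zeros of `s22` in `D₋`; these zeros
are finitely many and simple, and neither coefficient vanishes on `Σ`. -/
structure IsDiscreteSpectrum (s11 s22 : ℂ → ℂ) (L1 L2 : Finset ℂ) : Prop where
  mem_L1 : ∀ z : ℂ, z ∈ L1 ↔ 0 < (z ^ 2).im ∧ s11 z = 0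
  mem_L2 : ∀ z : ℂ, z ∈ L2 ↔ (z ^ 2).im < 0 ∧ s22 z = 0
  simple_L1 : ∀ z ∈ L1, deriv s11 z ≠ 0
  simple_L2 : ∀ z ∈ L2, deriv s22 z ≠ 0
  s11_ne : ∀ z : ℂ, (z ^ 2).im = 0 → s11 z ≠ 0
  s22_ne : ∀ z : ℂ, (z ^ 2).im = 0 → s22 z ≠ 0

/-- The integrals of `f` over the counterclockwise circles of radius `r` about `a` converge to `c`
as `r → 0+`. -/
def HasCircleLimit (f : ℂ → ℂ) (a c : ℂ) : Prop :=
  (∀ᶠ r : ℝ in 𝓝[>] 0, CircleIntegrable f a r) ∧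
    Tendsto (fun r : ℝ => ∮ z in C(a, r), f z) (𝓝[>] 0) (𝓝 c)

/-- The integral of `F` along `Σ`, each of the four half axes being run through in the direction
that keeps `D₊` on its left: from `±i∞` to `0`, and from `0` to `±∞`. -/
def sigmaIntegral (F : ℂ → ℂ) : ℂ :=
  ∫ s in Set.Ioi (0 : ℝ),
    (F s - F (-s) - Complex.I * F (Complex.I * s) + Complex.I * F (-(Complex.I * s)))

/-- The integral over `Σ` of `∫ K(·, y) dy` is absolutely convergent. -/
def SigmaIntegrable (K : ℂ → ℝ → ℂ) : Prop :=
  ∀ d : ℂ, d = 1 ∨ d = -1 ∨ d = Complex.I ∨ d = -Complex.I →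
    (∀ s : ℝ, 0 < s → Integrable (K (d * s))) ∧
      IntegrableOn (fun s : ℝ => ∫ y : ℝ, K (d * s) y) (Set.Ioi 0)

/-- `total` is the value of `∫_Γ ∫_ℝ K(spec, y) dy dspec`, where `Γ` is the contour that is obtained
when the arc around the points of `L` is drawn in onto these points and onto `Σ`: it consists of
`Σ`, run through backwards, and of vanishingly small circles about the points of `L`, which are
counterclockwise for `orient = 1` and clockwise for `orient = -1`.  On the circles the contour
integration is carried out for fixed `y`, before the integration over `y`. -/
def HasGammaIntegral (orient : ℂ) (L : Finset ℂ) (K : ℂ → ℝ → ℂ) (total : ℂ) : Prop :=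
  SigmaIntegrable K ∧
    ∃ c : ℂ → ℝ → ℂ,
      (∀ a ∈ L, ∀ y : ℝ, HasCircleLimit (fun z => K z y) a (c a y)) ∧
      (∀ a ∈ L, Integrable (c a)) ∧
      total = -sigmaIntegral (fun z => ∫ y : ℝ, K z y) + orient * ∑ a ∈ L, ∫ y : ℝ, c a y

/-- The integrand over `Γ₊`:
`|2 spec²|^(2 eps) / (spec³ s11²) ∂ₓ((φ₁₁⁻(x))²) ((φ₁₂⁺(y))² q_y^*(y) - (φ₂₂⁺(y))² q_y(y))`. -/
def kernelPlus (eps : ℝ) (u : ℝ → ℂ) (J : Columns) (s11 : ℂ → ℂ) (x : ℝ) (spec : ℂ) (y : ℝ) : ℂ :=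
  ((‖2 * spec ^ 2‖ ^ (2 * eps) : ℝ) : ℂ) / (spec ^ 3 * s11 spec ^ 2)
    * deriv (fun x' : ℝ => (J.m1 spec x' 0) ^ 2) x
    * ((J.p2 spec y 0) ^ 2 * (starRingEnd ℂ) (u y) - (J.p2 spec y 1) ^ 2 * u y)

/-- The integrand over `Γ₋`:
`|2 spec²|^(2 eps) / (spec³ s22²) ∂ₓ((φ₁₂⁻(x))²) ((φ₁₁⁺(y))² q_y^*(y) - (φ₂₁⁺(y))² q_y(y))`. -/
def kernelMinus (eps : ℝ) (u : ℝ → ℂ) (J : Columns) (s22 : ℂ → ℂ) (x : ℝ) (spec : ℂ) (y : ℝ) : ℂ :=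
  ((‖2 * spec ^ 2‖ ^ (2 * eps) : ℝ) : ℂ) / (spec ^ 3 * s22 spec ^ 2)
    * deriv (fun x' : ℝ => (J.m2 spec x' 0) ^ 2) x
    * ((J.p1 spec y 0) ^ 2 * (starRingEnd ℂ) (u y) - (J.p1 spec y 1) ^ 2 * u y)

/-- The spatial decay required of a potential at a fixed time: `f` decays faster than every power,
`f' ∈ L¹ ∩ L³` and `f'' ∈ L¹`. -/
structure IsDecaying (f : ℝ → ℂ) : Prop where
  rapid : ∀ n : ℕ, Tendsto (fun x : ℝ => |x| ^ n * ‖f x‖) (cocompact ℝ) (𝓝 0)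
  deriv_L1 : MemLp (deriv f) 1
  deriv_L3 : MemLp (deriv f) 3
  deriv2_L1 : MemLp (deriv (deriv f)) 1

/-- `q` is an exact solution of the fractional Fokas–Lenells equation
`q_xt = -(1/4π) ∫_{Γ₊} ∫_ℝ kernelPlus dy dspec + (1/4π) ∫_{Γ₋} ∫_ℝ kernelMinus dy dspec`
at every point `(x, t)`. -/
def IsSolution (eps : ℝ) (q : ℝ → ℝ → ℂ) : Prop :=
  ContDiff ℝ (⊤ : ℕ∞) (fun p : ℝ × ℝ => q p.1 p.2) ∧
  ∀ t : ℝ, IsDecaying (fun x => q x t) ∧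
    ∃ (J : Columns) (s11 s22 : ℂ → ℂ) (L1 L2 : Finset ℂ),
      IsJost (deriv fun x => q x t) J ∧
      IsScattering J s11 s22 ∧
      IsDiscreteSpectrum s11 s22 L1 L2 ∧
      ∀ x : ℝ, ∃ Ip Im : ℂ,
        HasGammaIntegral 1 L1 (kernelPlus eps (deriv fun x' => q x' t) J s11 x) Ip ∧
        HasGammaIntegral (-1) L2 (kernelMinus eps (deriv fun x' => q x' t) J s22 x) Im ∧
        HasDerivAt (fun τ : ℝ => deriv (fun x' => q x' τ) x)
          (-(1 / (4 * (Real.pi : ℂ))) * Ip + 1 / (4 * (Real.pi : ℂ)) * Im) t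

/-- `θ_{1R}` -/
def thetaR (xi eta eps x t : ℝ) : ℝ :=
  2 * xi * eta * x
    + (2 : ℝ) ^ (2 * eps - 1) * xi * eta * (xi ^ 2 + eta ^ 2) ^ (2 * eps - 2) * t

/-- `θ_{1I}` -/
def thetaI (xi eta eps x t : ℝ) : ℝ :=
  -(xi ^ 2 - eta ^ 2) * x
    + (4 : ℝ) ^ (eps - 1) * (xi ^ 2 - eta ^ 2) * (xi ^ 2 + eta ^ 2) ^ (2 * eps - 2) * t

/-- `ϖ₁`, with the principal logarithm. -/
def varpi (xi eta : ℝ) (nu11 nu21 : ℂ) : ℂ :=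
  Complex.log (((xi : ℂ) + Complex.I * eta) * (‖nu11‖ : ℂ)
    / ((Real.sqrt (xi ^ 2 + eta ^ 2) : ℂ) * (‖nu21‖ : ℂ)))

/-- The fractional one-soliton `q^{[1]}`. -/
def oneSoliton (xi eta eps : ℝ) (nu11 nu21 : ℂ) (x t : ℝ) : ℂ :=
  2 * Complex.I * xi * eta * (starRingEnd ℂ) nu21
      * Complex.exp (2 * Complex.I * thetaI xi eta eps x t + varpi xi eta nu11 nu21)
    / (((xi : ℂ) + Complex.I * eta) ^ 2 * ((xi : ℂ) - Complex.I * eta) * (starRingEnd ℂ) nu11)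
    * sech (2 * thetaR xi eta eps x t + varpi xi eta nu11 nu21)

end

end FracFL

/-!
At a fixed time the one-soliton is the potential produced by a Darboux transformation of the zero
potential.  With `l = xi + i eta`, `L = l^*`, a solution `f` of the Lax equation of the zero
potential at `l`, and `A = |f₁|²`, `B = |f₂|²`, `N = f₁ f₂^*`, `D = l A + L B`, `E = D^*`, one has
`q = (l² - L²) N / (l L D)`, and the dressing matrix at the spectral parameter `z` has the diagonal
`1 - z² E / (l L D)`, `1 - z² D / (l L E)` and the off-diagonal entries `z q`, `-z q^*`.  Hence the
Jost functions are explicit (`Soliton.isJost`), `s11 = (1 - z² / l²) / (1 - z² / L²)`, `s22` is its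
reciprocal, and the discrete spectrum is `{l, -l}` in `D₊` and `{L, -L}` in `D₋`.

The factor of the kernels that depends on `y` is a total derivative in `y`
(`Soliton.hasDerivAt_primitive`).  Its integral is zero for `z` on `Σ`, because the soliton is
reflectionless, and also at the points of the discrete spectrum.  There the kernels have poles of
the second order, with a numerator that contains the non-holomorphic weight `|2 z²|^(2 eps)`; the
integrals over small circles see only its Wirtinger derivative
(`hasCircleLimit_of_hasFDerivAt`).  By the product rule, after the integration over `y` only the
term survives in which the `y`-dependent factor is differentiated, so that the weight enters
through its value `|2 l²|^(2 eps)` alone (`hasGammaIntegral_of_reflectionless`).  The surviving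
integral is a boundary term at `y = -∞` (`Soliton.integral_Y'_l`).  The contribution of `D₋`
follows from that of `D₊` by the conjugation symmetry of the Lax equation (`Soliton.Yc_eq`).

The equation then reduces to an identity between rational expressions in `A`, `B`, `N`, whose
exponents are linear in `t` with rates proportional to `|2 l²|^(2 eps)` (`hasDerivAt_u`).
-/

namespace FracFL

noncomputable section

/-! ### The soliton at a fixed time -/

/-- The data of a soliton at a fixed time: the eigenvalue `xi + i eta`, and the values `a` and `n`
at `x = 0` of the products `|f₁|²` and `f₁ f₂^*`, where `f = (f₁, f₂)` solves the Lax equation of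
the zero potential at the eigenvalue. -/
structure Soliton where
  /-- the real part of the eigenvalue -/
  xi : ℝ
  /-- the imaginary part of the eigenvalue -/
  eta : ℝ
  /-- the value of `|f₁|²` at `x = 0` -/
  a : ℝ
  /-- the value of `f₁ f₂^*` at `x = 0` -/
  n : ℂ
  xi_pos : 0 < xi
  eta_pos : 0 < eta
  a_pos : 0 < a
  n_ne : n ≠ 0

namespace Soliton

variable (S : Soliton)

/-- The eigenvalue `xi + i eta`, which lies in `D₊`. -/
def l : ℂ := S.xi + Complex.I * S.eta

/-- The complex conjugate of the eigenvalue, which lies in `D₋`. -/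
def L : ℂ := S.xi - Complex.I * S.eta

/-- `|f₁|²` -/
def A (x : ℝ) : ℝ := S.a * Real.exp (4 * S.xi * S.eta * x)

/-- `|f₂|²` -/
def B (x : ℝ) : ℝ := ‖S.n‖ ^ 2 / S.a * Real.exp (-(4 * S.xi * S.eta * x))

/-- `f₁ f₂^*` -/
def N (x : ℝ) : ℂ := S.n * Complex.exp (-Complex.I * (S.l ^ 2 + S.L ^ 2) * x)

/-- `f₁^* f₂` -/
def M (x : ℝ) : ℂ := (starRingEnd ℂ) S.n * Complex.exp (Complex.I * (S.l ^ 2 + S.L ^ 2) * x)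

/-- The denominator of the dressing matrix. -/
def D (x : ℝ) : ℂ := S.l * S.A x + S.L * S.B x

/-- The complex conjugate of `D`. -/
def E (x : ℝ) : ℂ := S.L * S.A x + S.l * S.B x

/-- The potential. -/
def q (x : ℝ) : ℂ := (S.l ^ 2 - S.L ^ 2) * S.N x / (S.l * S.L * S.D x)

/-- The complex conjugate of the potential. -/
def qc (x : ℝ) : ℂ := -((S.l ^ 2 - S.L ^ 2) * S.M x / (S.l * S.L * S.E x))

/-- The derivative of the potential. -/
def u (x : ℝ) : ℂ := -2 * Complex.I * (S.l ^ 2 - S.L ^ 2) * S.N x * S.E x / S.D x ^ 2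

/-- The complex conjugate of the derivative of the potential. -/
def uc (x : ℝ) : ℂ := -2 * Complex.I * (S.l ^ 2 - S.L ^ 2) * S.M x * S.D x / S.E x ^ 2

lemma conj_l : (starRingEnd ℂ) S.l = S.L := by
  simp [l, L, sub_eq_add_neg]

lemma conj_L : (starRingEnd ℂ) S.L = S.l := by
  simp [l, L]

lemma l_re : S.l.re = S.xi := by simp [l]
lemma l_im : S.l.im = S.eta := by simp [l]

lemma l_ne : S.l ≠ 0 := by
  intro h
  have := S.xi_pos
  rw [← S.l_re, h] at this
  simp at this

lemma L_ne : S.L ≠ 0 := by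
  rw [← S.conj_l]
  simpa using S.l_ne

lemma l_sq_im : (S.l ^ 2).im = 2 * S.xi * S.eta := by
  rw [sq, Complex.mul_im, l_re, l_im]; ring

lemma l_sq_im_pos : 0 < (S.l ^ 2).im := by
  rw [S.l_sq_im]
  have := S.xi_pos
  have := S.eta_pos
  positivity

lemma L_sq_im_neg : (S.L ^ 2).im < 0 := by
  rw [← S.conj_l, ← map_pow, Complex.conj_im]
  have := S.l_sq_im_pos
  linarith

/-- `l² - L²` is purely imaginary. -/
lemma l_sq_sub : S.l ^ 2 - S.L ^ 2 = Complex.I * (4 * S.xi * S.eta) := by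
  simp only [l, L]; ring

lemma l_sq_add : S.l ^ 2 + S.L ^ 2 = ((2 * (S.xi ^ 2 - S.eta ^ 2) : ℝ) : ℂ) := by
  simp only [l, L]
  push_cast
  linear_combination (2 * (S.eta : ℂ) ^ 2) * Complex.I_sq

lemma l_mul_L : S.l * S.L = ((S.xi ^ 2 + S.eta ^ 2 : ℝ) : ℂ) := by
  simp only [l, L]
  push_cast
  linear_combination (-(S.eta : ℂ) ^ 2) * Complex.I_sq

lemma l_sq_sub_ne : S.l ^ 2 - S.L ^ 2 ≠ 0 := by
  rw [S.l_sq_sub]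
  have h1 : (S.xi : ℂ) ≠ 0 := by exact_mod_cast S.xi_pos.ne'
  have h2 : (S.eta : ℂ) ≠ 0 := by exact_mod_cast S.eta_pos.ne'
  simp [h1, h2]

lemma A_pos (x : ℝ) : 0 < S.A x := mul_pos S.a_pos (Real.exp_pos _)

lemma norm_n_pos : 0 < ‖S.n‖ := norm_pos_iff.2 S.n_ne

lemma B_pos (x : ℝ) : 0 < S.B x :=
  mul_pos (div_pos (pow_pos S.norm_n_pos 2) S.a_pos) (Real.exp_pos _)

/-- The product `A B` does not depend on `x`; it is what turns most expressions at the eigenvalues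
into constants over powers of `D` and `E`. -/
lemma A_mul_B (x : ℝ) : S.A x * S.B x = ‖S.n‖ ^ 2 := by
  have := S.a_pos.ne'
  simp only [A, B]
  rw [Real.exp_neg]
  have := (Real.exp_pos (4 * S.xi * S.eta * x)).ne'
  field_simp

lemma n_mul_conj : S.n * (starRingEnd ℂ) S.n = (‖S.n‖ : ℂ) ^ 2 := by
  rw [Complex.mul_conj, Complex.normSq_eq_norm_sq]
  push_cast; rfl

lemma A_mul_B' (x : ℝ) : (S.A x : ℂ) * S.B x = S.n * (starRingEnd ℂ) S.n := by
  rw [S.n_mul_conj]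
  exact_mod_cast S.A_mul_B x

lemma N_mul_M (x : ℝ) : S.N x * S.M x = S.A x * S.B x := by
  rw [S.A_mul_B']
  have h : Complex.exp (-Complex.I * (S.l ^ 2 + S.L ^ 2) * x)
      * Complex.exp (Complex.I * (S.l ^ 2 + S.L ^ 2) * x) = 1 := by
    rw [← Complex.exp_add, ← Complex.exp_zero]
    congr 1; ring
  simp only [N, M]
  linear_combination (S.n * (starRingEnd ℂ) S.n) * h

lemma conj_N (x : ℝ) : (starRingEnd ℂ) (S.N x) = S.M x := by
  simp only [N, M, S.l_sq_add, map_mul, ← Complex.exp_conj, map_neg, Complex.conj_I,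
    Complex.conj_ofReal, neg_neg]

lemma norm_N (x : ℝ) : ‖S.N x‖ = ‖S.n‖ := by
  have h : -Complex.I * (S.l ^ 2 + S.L ^ 2) * x
      = ((-(2 * (S.xi ^ 2 - S.eta ^ 2)) * x : ℝ) : ℂ) * Complex.I := by
    rw [S.l_sq_add]; push_cast; ring
  rw [N, norm_mul, h, Complex.norm_exp_ofReal_mul_I, mul_one]

lemma conj_D (x : ℝ) : (starRingEnd ℂ) (S.D x) = S.E x := by
  simp [D, E, S.conj_l, S.conj_L]

lemma D_re (x : ℝ) : (S.D x).re = S.xi * (S.A x + S.B x) := by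
  simp [D, l, L]; ring

lemma D_ne (x : ℝ) : S.D x ≠ 0 := by
  intro h
  have h1 := S.D_re x
  have : 0 < S.xi * (S.A x + S.B x) := mul_pos S.xi_pos (add_pos (S.A_pos x) (S.B_pos x))
  rw [h] at h1
  simp only [Complex.zero_re] at h1
  linarith

lemma E_ne (x : ℝ) : S.E x ≠ 0 := by
  rw [← S.conj_D]
  simpa using S.D_ne x

lemma conj_q (x : ℝ) : (starRingEnd ℂ) (S.q x) = S.qc x := by
  simp only [q, qc, map_div₀, map_mul, map_sub, map_pow, S.conj_l, S.conj_L, S.conj_N, S.conj_D]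
  rw [mul_comm S.L S.l]; ring

lemma conj_u (x : ℝ) : (starRingEnd ℂ) (S.u x) = S.uc x := by
  have h : (starRingEnd ℂ) (S.E x) = S.D x := by rw [← S.conj_D, Complex.conj_conj]
  simp only [u, uc, map_div₀, map_mul, map_sub, map_pow, map_neg, Complex.conj_I, S.conj_l,
    S.conj_L, S.conj_N, S.conj_D, h, map_ofNat]
  ring

lemma hasDerivAt_A (x : ℝ) :
    HasDerivAt (fun y : ℝ => (S.A y : ℂ)) (-Complex.I * (S.l ^ 2 - S.L ^ 2) * S.A x) x := by
  have h : HasDerivAt S.A (4 * S.xi * S.eta * S.A x) x := by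
    have := (((hasDerivAt_id x).const_mul (4 * S.xi * S.eta)).exp).const_mul S.a
    refine this.congr_deriv ?_
    simp only [A, id]; ring
  refine h.ofReal_comp.congr_deriv ?_
  rw [S.l_sq_sub]
  push_cast
  linear_combination (4 * S.xi * S.eta * S.A x : ℂ) * Complex.I_sq

lemma hasDerivAt_B (x : ℝ) :
    HasDerivAt (fun y : ℝ => (S.B y : ℂ)) (Complex.I * (S.l ^ 2 - S.L ^ 2) * S.B x) x := by
  have h : HasDerivAt S.B (-(4 * S.xi * S.eta * S.B x)) x := by
    have := (((hasDerivAt_id x).const_mul (4 * S.xi * S.eta)).neg.exp).const_mul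
      (‖S.n‖ ^ 2 / S.a)
    refine this.congr_deriv ?_
    simp only [B, id, Pi.neg_apply]; ring
  refine h.ofReal_comp.congr_deriv ?_
  rw [S.l_sq_sub]
  push_cast
  linear_combination (-(4 * S.xi * S.eta * S.B x : ℂ)) * Complex.I_sq

lemma hasDerivAt_cexp (c : ℂ) (x : ℝ) :
    HasDerivAt (fun y : ℝ => Complex.exp (c * y)) (c * Complex.exp (c * x)) x := by
  have := ((Complex.ofRealCLM.hasDerivAt (x := x)).const_mul c).cexp
  simpa [mul_comm] using this

lemma hasDerivAt_N (x : ℝ) :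
    HasDerivAt S.N (-Complex.I * (S.l ^ 2 + S.L ^ 2) * S.N x) x := by
  have := (hasDerivAt_cexp (-Complex.I * (S.l ^ 2 + S.L ^ 2)) x).const_mul S.n
  refine this.congr_deriv ?_
  simp only [N]; ring

lemma hasDerivAt_M (x : ℝ) :
    HasDerivAt S.M (Complex.I * (S.l ^ 2 + S.L ^ 2) * S.M x) x := by
  have := (hasDerivAt_cexp (Complex.I * (S.l ^ 2 + S.L ^ 2)) x).const_mul ((starRingEnd ℂ) S.n)
  refine this.congr_deriv ?_
  simp only [M]; ring

lemma hasDerivAt_D (x : ℝ) :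
    HasDerivAt S.D (-Complex.I * (S.l ^ 2 - S.L ^ 2) * (S.l * S.A x - S.L * S.B x)) x := by
  have := ((S.hasDerivAt_A x).const_mul S.l).add ((S.hasDerivAt_B x).const_mul S.L)
  refine this.congr_deriv ?_
  ring

lemma hasDerivAt_E (x : ℝ) :
    HasDerivAt S.E (-Complex.I * (S.l ^ 2 - S.L ^ 2) * (S.L * S.A x - S.l * S.B x)) x := by
  have := ((S.hasDerivAt_A x).const_mul S.L).add ((S.hasDerivAt_B x).const_mul S.l)
  refine this.congr_deriv ?_
  ring

lemma hasDerivAt_q (x : ℝ) : HasDerivAt S.q (S.u x) x := by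
  have hD := S.D_ne x
  have hl := S.l_ne
  have hL := S.L_ne
  have := ((S.hasDerivAt_N x).const_mul (S.l ^ 2 - S.L ^ 2)).div
    ((S.hasDerivAt_D x).const_mul (S.l * S.L)) (by simp [hl, hL, hD])
  refine this.congr_deriv ?_
  simp only [u]
  field_simp
  simp only [D, E]
  ring

lemma hasDerivAt_qc (x : ℝ) : HasDerivAt S.qc (S.uc x) x := by
  have hE := S.E_ne x
  have hl := S.l_ne
  have hL := S.L_ne
  have := (((S.hasDerivAt_M x).const_mul (S.l ^ 2 - S.L ^ 2)).div
    ((S.hasDerivAt_E x).const_mul (S.l * S.L)) (by simp [hl, hL, hE])).neg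
  refine this.congr_deriv ?_
  simp only [uc]
  field_simp
  simp only [D, E]
  ring

lemma deriv_q : deriv S.q = S.u := funext fun x => (S.hasDerivAt_q x).deriv

/-! ### The dressing matrix -/

/-- The upper diagonal entry of the dressing matrix, with `g` for the squared spectral
parameter. -/
def T11 (g : ℂ) (x : ℝ) : ℂ := 1 - g * S.E x / (S.l * S.L * S.D x)

/-- The lower diagonal entry of the dressing matrix, with `g` for the squared spectral
parameter. -/
def T22 (g : ℂ) (x : ℝ) : ℂ := 1 - g * S.D x / (S.l * S.L * S.E x)

/-- The first column of the dressed wave matrix. -/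
def col1 (z : ℂ) (x : ℝ) : Fin 2 → ℂ :=
  ![S.T11 (z ^ 2) x * Complex.exp (-Complex.I * z ^ 2 * x),
    -z * S.qc x * Complex.exp (-Complex.I * z ^ 2 * x)]

/-- The second column of the dressed wave matrix. -/
def col2 (z : ℂ) (x : ℝ) : Fin 2 → ℂ :=
  ![z * S.q x * Complex.exp (Complex.I * z ^ 2 * x),
    S.T22 (z ^ 2) x * Complex.exp (Complex.I * z ^ 2 * x)]

lemma hasDerivAt_T11 (g : ℂ) (x : ℝ) :
    HasDerivAt (S.T11 g) (-g * S.u x * S.qc x) x := by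
  have hD := S.D_ne x
  have hE := S.E_ne x
  have hl := S.l_ne
  have hL := S.L_ne
  have := (((S.hasDerivAt_E x).const_mul g).div
    ((S.hasDerivAt_D x).const_mul (S.l * S.L)) (by simp [hl, hL, hD])).const_sub 1
  refine this.congr_deriv ?_
  have hN := S.N_mul_M x
  simp only [u, qc]
  field_simp
  simp only [D, E]
  linear_combination (2 * g * (S.l ^ 2 - S.L ^ 2) ^ 2) * hN

lemma hasDerivAt_T22 (g : ℂ) (x : ℝ) :
    HasDerivAt (S.T22 g) (-g * S.uc x * S.q x) x := by
  have hD := S.D_ne x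
  have hE := S.E_ne x
  have hl := S.l_ne
  have hL := S.L_ne
  have := (((S.hasDerivAt_D x).const_mul g).div
    ((S.hasDerivAt_E x).const_mul (S.l * S.L)) (by simp [hl, hL, hE])).const_sub 1
  refine this.congr_deriv ?_
  have hN := S.N_mul_M x
  simp only [uc, q]
  field_simp
  simp only [D, E]
  linear_combination (-2 * g * (S.l ^ 2 - S.L ^ 2) ^ 2) * hN

/-- A form of `u D / (l L E) = -2 i q`, which gives the Lax equation for the entry `z q` of the
dressing matrix. -/
lemma u_mul_T22 (g : ℂ) (x : ℝ) :
    S.u x * S.T22 g x = S.u x + 2 * Complex.I * g * S.q x := by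
  have hD := S.D_ne x
  have hE := S.E_ne x
  have hl := S.l_ne
  have hL := S.L_ne
  simp only [u, T22, q]
  field_simp
  ring

lemma uc_mul_T11 (g : ℂ) (x : ℝ) :
    S.uc x * S.T11 g x = S.uc x - 2 * Complex.I * g * S.qc x := by
  have hD := S.D_ne x
  have hE := S.E_ne x
  have hl := S.l_ne
  have hL := S.L_ne
  simp only [uc, T11, qc]
  field_simp
  ring

lemma isWave_col1 (z : ℂ) : IsWave S.u z (S.col1 z) := by
  intro x
  rw [hasDerivAt_pi]
  have he := hasDerivAt_cexp (-Complex.I * z ^ 2) x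
  have h := S.uc_mul_T11 (z ^ 2) x
  intro i
  fin_cases i
  · refine ((S.hasDerivAt_T11 (z ^ 2) x).mul he).congr_deriv ?_
    simp [laxU, col1, Matrix.mulVec, dotProduct, Fin.sum_univ_two]
    ring
  · refine (((S.hasDerivAt_qc x).const_mul (-z)).mul he).congr_deriv ?_
    simp [laxU, col1, Matrix.mulVec, dotProduct, Fin.sum_univ_two, S.conj_u]
    linear_combination (z * Complex.exp (-(Complex.I * z ^ 2 * x))) * h

lemma isWave_col2 (z : ℂ) : IsWave S.u z (S.col2 z) := by
  intro x
  rw [hasDerivAt_pi]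
  have he := hasDerivAt_cexp (Complex.I * z ^ 2) x
  have h := S.u_mul_T22 (z ^ 2) x
  intro i
  fin_cases i
  · refine (((S.hasDerivAt_q x).const_mul z).mul he).congr_deriv ?_
    simp [laxU, col2, Matrix.mulVec, dotProduct, Fin.sum_univ_two]
    linear_combination (-z * Complex.exp (Complex.I * z ^ 2 * x)) * h
  · refine ((S.hasDerivAt_T22 (z ^ 2) x).mul he).congr_deriv ?_
    simp [laxU, col2, Matrix.mulVec, dotProduct, Fin.sum_univ_two, S.conj_u]
    ring

lemma isWave_smul {v : ℝ → ℂ} {z : ℂ} {phi : ℝ → Fin 2 → ℂ} (h : IsWave v z phi) (c : ℂ) :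
    IsWave v z (fun x => c • phi x) := by
  intro x
  have := (h x).const_smul c
  rwa [← Matrix.mulVec_smul] at this

/-- The determinant of the dressing matrix. -/
lemma colDet_col (z : ℂ) (x : ℝ) :
    colDet (S.col1 z x) (S.col2 z x) = (1 - z ^ 2 / S.l ^ 2) * (1 - z ^ 2 / S.L ^ 2) := by
  have hD := S.D_ne x
  have hE := S.E_ne x
  have hl := S.l_ne
  have hL := S.L_ne
  have hN := S.N_mul_M x
  have h : Complex.exp (-Complex.I * z ^ 2 * x) * Complex.exp (Complex.I * z ^ 2 * x) = 1 := by
    rw [← Complex.exp_add, ← Complex.exp_zero]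
    congr 1; ring
  have h2 : S.T11 (z ^ 2) x * S.T22 (z ^ 2) x + z ^ 2 * S.q x * S.qc x
      = (1 - z ^ 2 / S.l ^ 2) * (1 - z ^ 2 / S.L ^ 2) := by
    have h3 : S.D x * S.E x = S.l * S.L * (S.A x ^ 2 + S.B x ^ 2)
        + (S.l ^ 2 + S.L ^ 2) * (S.N x * S.M x) := by
      rw [hN]; simp only [D, E]; ring
    have h4 : S.D x ^ 2 + S.E x ^ 2 = (S.l ^ 2 + S.L ^ 2) * (S.A x ^ 2 + S.B x ^ 2)
        + 4 * (S.l * S.L) * (S.N x * S.M x) := by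
      rw [hN]; simp only [D, E]; ring
    simp only [T11, T22, q, qc]
    field_simp
    linear_combination (z ^ 2 * (S.l ^ 2 + S.L ^ 2)) * h3 - (z ^ 2 * S.l * S.L) * h4
  simp only [colDet, Matrix.det_fin_two_of, col1, col2, Matrix.cons_val_zero, Matrix.cons_val_one]
  linear_combination (S.T11 (z ^ 2) x * S.T22 (z ^ 2) x + z ^ 2 * S.q x * S.qc x) * h + h2

/-! ### Bounds and limits -/

lemma norm_L : ‖S.L‖ = ‖S.l‖ := by rw [← S.conj_l, Complex.norm_conj]

lemma norm_E (x : ℝ) : ‖S.E x‖ = ‖S.D x‖ := by rw [← S.conj_D, Complex.norm_conj]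

lemma norm_D_pos (x : ℝ) : 0 < ‖S.D x‖ := norm_pos_iff.2 (S.D_ne x)

lemma xi_mul_le_norm_D (x : ℝ) : S.xi * (S.A x + S.B x) ≤ ‖S.D x‖ := by
  rw [← S.D_re]
  exact Complex.re_le_norm _

/-- The denominator grows exponentially in both directions. -/
lemma exists_exp_le_norm_D :
    ∃ c > 0, ∃ k > 0, ∀ x : ℝ, c * Real.exp (k * |x|) ≤ ‖S.D x‖ := by
  have hx := S.xi_pos
  have he := S.eta_pos
  have ha := S.a_pos
  have hb : 0 < ‖S.n‖ ^ 2 / S.a := div_pos (pow_pos S.norm_n_pos 2) S.a_pos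
  refine ⟨S.xi * min S.a (‖S.n‖ ^ 2 / S.a), mul_pos hx (lt_min ha hb), 4 * S.xi * S.eta,
    by positivity, fun x => ?_⟩
  refine le_trans ?_ (S.xi_mul_le_norm_D x)
  rw [mul_assoc]
  refine mul_le_mul_of_nonneg_left ?_ hx.le
  rcases le_total 0 x with h | h
  · rw [abs_of_nonneg h]
    exact le_add_of_le_of_nonneg
      (mul_le_mul_of_nonneg_right (min_le_left _ _) (Real.exp_pos _).le) (S.B_pos x).le
  · rw [abs_of_nonpos h, mul_neg]
    exact le_add_of_nonneg_of_le (S.A_pos x).le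
      (mul_le_mul_of_nonneg_right (min_le_right _ _) (Real.exp_pos _).le)

lemma exists_sq_le_norm_D : ∃ c > 0, ∀ x : ℝ, c * (1 + x ^ 2) ≤ ‖S.D x‖ := by
  obtain ⟨c, hc, k, hk, h⟩ := S.exists_exp_le_norm_D
  refine ⟨c * min 1 (k ^ 2 / 2), by positivity, fun x => le_trans ?_ (h x)⟩
  rw [mul_assoc]
  refine mul_le_mul_of_nonneg_left ?_ hc.le
  have h1 := Real.quadratic_le_exp_of_nonneg (x := k * |x|) (by positivity)
  have h2 : min 1 (k ^ 2 / 2) ≤ 1 := min_le_left _ _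
  have h3 : min 1 (k ^ 2 / 2) * x ^ 2 ≤ k ^ 2 / 2 * x ^ 2 :=
    mul_le_mul_of_nonneg_right (min_le_right _ _) (sq_nonneg x)
  have h4 : (k * |x|) ^ 2 = k ^ 2 * x ^ 2 := by rw [mul_pow, sq_abs]
  have h5 : 0 ≤ k * |x| := by positivity
  nlinarith

lemma norm_sub_le_norm_D (c : ℂ) (d : ℂ) (x : ℝ) :
    ‖c * S.A x - d * S.B x‖ ≤ (‖c‖ + ‖d‖) / S.xi * ‖S.D x‖ := by
  have h1 := S.A_pos x
  have h2 := S.B_pos x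
  have hx := S.xi_pos
  calc ‖c * S.A x - d * S.B x‖ ≤ ‖c * S.A x‖ + ‖d * S.B x‖ := norm_sub_le _ _
    _ = ‖c‖ * S.A x + ‖d‖ * S.B x := by
        rw [norm_mul, norm_mul, Complex.norm_of_nonneg h1.le, Complex.norm_of_nonneg h2.le]
    _ ≤ (‖c‖ + ‖d‖) / S.xi * (S.xi * (S.A x + S.B x)) := by
        have : (‖c‖ + ‖d‖) / S.xi * (S.xi * (S.A x + S.B x)) = (‖c‖ + ‖d‖) * (S.A x + S.B x) := by
          field_simp
        rw [this]
        nlinarith [norm_nonneg c, norm_nonneg d]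
    _ ≤ _ := mul_le_mul_of_nonneg_left (S.xi_mul_le_norm_D x) (by positivity)

lemma norm_q (x : ℝ) : ‖S.q x‖ = ‖S.l ^ 2 - S.L ^ 2‖ * ‖S.n‖ / ‖S.l * S.L‖ / ‖S.D x‖ := by
  rw [q, norm_div, norm_mul, norm_mul, S.norm_N, div_div]

lemma norm_u (x : ℝ) : ‖S.u x‖ = 2 * ‖S.l ^ 2 - S.L ^ 2‖ * ‖S.n‖ / ‖S.D x‖ := by
  have := (S.norm_D_pos x).ne'
  rw [u, norm_div, norm_mul, norm_mul, norm_mul, norm_mul, S.norm_N, S.norm_E, norm_pow]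
  simp only [norm_neg, Complex.norm_I, Complex.norm_ofNat]
  field_simp

lemma continuous_D : Continuous S.D :=
  continuous_iff_continuousAt.2 fun x => (S.hasDerivAt_D x).continuousAt
lemma continuous_E : Continuous S.E :=
  continuous_iff_continuousAt.2 fun x => (S.hasDerivAt_E x).continuousAt
lemma continuous_N : Continuous S.N :=
  continuous_iff_continuousAt.2 fun x => (S.hasDerivAt_N x).continuousAt
lemma continuous_q : Continuous S.q :=
  continuous_iff_continuousAt.2 fun x => (S.hasDerivAt_q x).continuousAt
lemma continuous_T22 (g : ℂ) : Continuous (S.T22 g) :=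
  continuous_iff_continuousAt.2 fun x => (S.hasDerivAt_T22 g x).continuousAt

lemma continuous_u : Continuous S.u := by
  have h1 := S.continuous_N
  have h2 := S.continuous_E
  have h3 := S.continuous_D
  exact ((continuous_const.mul h1).mul h2).div (h3.pow 2) fun x => pow_ne_zero 2 (S.D_ne x)

lemma continuous_uc : Continuous S.uc := by
  have : S.uc = fun x => (starRingEnd ℂ) (S.u x) := funext fun x => (S.conj_u x).symm
  rw [this]
  exact Complex.continuous_conj.comp S.continuous_u

/-- The criterion of integrability for everything that decays like the reciprocal of the
denominator. -/
lemma integrable_of_norm_le {f : ℝ → ℂ} (hf : AEStronglyMeasurable f volume) {C : ℝ}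
    (h : ∀ x, ‖f x‖ ≤ C / ‖S.D x‖) : Integrable f := by
  obtain ⟨c, hc, hD⟩ := S.exists_sq_le_norm_D
  have hC : 0 ≤ C := by
    have h0 := (norm_nonneg _).trans (h 0)
    by_contra hC
    exact absurd h0 (not_le.2 (div_neg_of_neg_of_pos (not_le.1 hC) (S.norm_D_pos 0)))
  refine (integrable_inv_one_add_sq.const_mul (C / c)).mono' hf (ae_of_all _ fun x => ?_)
  refine (h x).trans ?_
  have : C / c * (1 + x ^ 2)⁻¹ = C / (c * (1 + x ^ 2)) := by
    rw [← div_eq_mul_inv, div_div]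
  rw [this]
  exact div_le_div_of_nonneg_left hC (by positivity) (hD x)

/-- A variant of the criterion with a linearly growing factor. -/
lemma integrable_of_norm_le_mul {f : ℝ → ℂ} (hf : AEStronglyMeasurable f volume) {C : ℝ}
    (h : ∀ x, ‖f x‖ ≤ C * (1 + |x|) / ‖S.D x‖ ^ 2) : Integrable f := by
  obtain ⟨c, hc, hD⟩ := S.exists_sq_le_norm_D
  have hC : 0 ≤ C := by
    have h0 := (norm_nonneg _).trans (h 0)
    by_contra hC
    have h1 := S.norm_D_pos 0
    rw [abs_zero, add_zero, mul_one] at h0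
    exact absurd h0 (not_le.2 (div_neg_of_neg_of_pos (not_le.1 hC) (by positivity)))
  refine S.integrable_of_norm_le hf (C := C * (2 / c)) fun x => (h x).trans ?_
  have h1 := S.norm_D_pos x
  have h2 : 1 + |x| ≤ 2 / c * ‖S.D x‖ := by
    have h3 : 1 + |x| ≤ 2 * (1 + x ^ 2) := by
      rw [← sq_abs x]; nlinarith [sq_nonneg (|x| - 1)]
    refine h3.trans ?_
    rw [div_mul_eq_mul_div, le_div_iff₀ hc]
    nlinarith [hD x]
  rw [div_le_div_iff₀ (by positivity) h1]
  nlinarith [mul_le_mul_of_nonneg_left h2 (by positivity : 0 ≤ C * ‖S.D x‖)]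

lemma integrable_u : Integrable S.u :=
  S.integrable_of_norm_le S.continuous_u.aestronglyMeasurable fun x => (S.norm_u x).le

lemma norm_T22_le (g : ℂ) (x : ℝ) : ‖S.T22 g x‖ ≤ 1 + ‖g‖ / ‖S.l * S.L‖ := by
  have h := (S.norm_D_pos x).ne'
  refine (norm_sub_le _ _).trans ?_
  rw [norm_one, norm_div, norm_mul, norm_mul, S.norm_E, mul_div_mul_right _ _ h]

lemma exists_norm_u_le : ∃ C, ∀ x, ‖S.u x‖ ≤ C := by
  obtain ⟨c, hc, hD⟩ := S.exists_sq_le_norm_D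
  refine ⟨2 * ‖S.l ^ 2 - S.L ^ 2‖ * ‖S.n‖ / c, fun x => ?_⟩
  rw [S.norm_u]
  refine div_le_div_of_nonneg_left (by positivity) hc ?_
  nlinarith [hD x, sq_nonneg x]

lemma memLp_u_one : MemLp S.u 1 := memLp_one_iff_integrable.2 S.integrable_u

lemma memLp_u_three : MemLp S.u 3 := by
  obtain ⟨C, hC⟩ := S.exists_norm_u_le
  rw [← integrable_norm_rpow_iff S.continuous_u.aestronglyMeasurable (by norm_num) (by norm_num)]
  have hm : Continuous fun x => ‖S.u x‖ ^ (3 : ENNReal).toReal := by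
    simp only [ENNReal.toReal_ofNat, Real.rpow_ofNat]
    exact S.continuous_u.norm.pow 3
  refine (S.integrable_u.norm.const_mul (C ^ 2)).mono' hm.aestronglyMeasurable
    (ae_of_all _ fun x => ?_)
  rw [ENNReal.toReal_ofNat, Real.rpow_ofNat, Real.norm_of_nonneg (by positivity), pow_succ]
  have := hC x
  gcongr

lemma integrable_deriv_u : Integrable (deriv S.u) := by
  set d := S.l ^ 2 - S.L ^ 2 with hd
  have hderiv : ∀ x, deriv S.u x = -2 * Complex.I * d
      * ((-Complex.I * (S.l ^ 2 + S.L ^ 2) * S.N x * S.E x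
        + S.N x * (-Complex.I * d * (S.L * S.A x - S.l * S.B x))) / S.D x ^ 2
      + 2 * Complex.I * d * S.N x * S.E x * (S.l * S.A x - S.L * S.B x) / S.D x ^ 3) := by
    intro x
    have hD := S.D_ne x
    have := ((((S.hasDerivAt_N x).const_mul (-2 * Complex.I * d)).mul (S.hasDerivAt_E x)).div
      ((S.hasDerivAt_D x).pow 2) (by simpa using hD))
    have h2 : HasDerivAt S.u _ x := this
    rw [h2.deriv]
    simp only [Pi.mul_apply, Pi.pow_apply]
    field_simp
    ring
  have hm : AEStronglyMeasurable (deriv S.u) volume := aestronglyMeasurable_deriv _ _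
  set K := (‖S.l‖ + ‖S.l‖) / S.xi with hK
  have hK0 : 0 ≤ K := div_nonneg (by positivity) S.xi_pos.le
  refine S.integrable_of_norm_le hm
    (C := 2 * ‖d‖ * (‖S.l ^ 2 + S.L ^ 2‖ * ‖S.n‖ + ‖S.n‖ * (‖d‖ * K) + 2 * ‖d‖ * ‖S.n‖ * K))
    fun x => ?_
  have hD := S.norm_D_pos x
  have h1 := S.norm_sub_le_norm_D S.L S.l x
  have h2 := S.norm_sub_le_norm_D S.l S.L x
  rw [S.norm_L, ← hK] at h1 h2
  rw [hderiv, norm_mul, mul_div_assoc (2 * ‖d‖)]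
  have e1 : ‖-2 * Complex.I * d‖ = 2 * ‖d‖ := by simp
  rw [e1]
  refine mul_le_mul_of_nonneg_left ?_ (by positivity)
  refine le_trans (norm_add_le _ _) ?_
  rw [add_div (‖S.l ^ 2 + S.L ^ 2‖ * ‖S.n‖ + ‖S.n‖ * (‖d‖ * K))]
  refine add_le_add ?_ ?_
  · rw [norm_div, norm_pow, div_le_div_iff₀ (by positivity) hD]
    have : ‖-Complex.I * (S.l ^ 2 + S.L ^ 2) * S.N x * S.E x
        + S.N x * (-Complex.I * d * (S.L * S.A x - S.l * S.B x))‖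
        ≤ ‖S.l ^ 2 + S.L ^ 2‖ * ‖S.n‖ * ‖S.D x‖ + ‖S.n‖ * (‖d‖ * (K * ‖S.D x‖)) := by
      refine (norm_add_le _ _).trans (add_le_add (le_of_eq ?_) ?_)
      · simp [S.norm_N, S.norm_E]
      · rw [norm_mul, norm_mul, norm_mul, norm_neg, Complex.norm_I, one_mul, S.norm_N]
        gcongr
    calc _ ≤ (‖S.l ^ 2 + S.L ^ 2‖ * ‖S.n‖ * ‖S.D x‖ + ‖S.n‖ * (‖d‖ * (K * ‖S.D x‖)))
          * ‖S.D x‖ := mul_le_mul_of_nonneg_right this hD.le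
      _ = _ := by ring
  · rw [norm_div, norm_pow, div_le_div_iff₀ (by positivity) hD]
    have : ‖2 * Complex.I * d * S.N x * S.E x * (S.l * S.A x - S.L * S.B x)‖
        ≤ 2 * ‖d‖ * ‖S.n‖ * ‖S.D x‖ * (K * ‖S.D x‖) := by
      rw [norm_mul]
      refine mul_le_mul (le_of_eq ?_) h2 (norm_nonneg _) (by positivity)
      simp [S.norm_N, S.norm_E]
    calc _ ≤ 2 * ‖d‖ * ‖S.n‖ * ‖S.D x‖ * (K * ‖S.D x‖) * ‖S.D x‖ :=
          mul_le_mul_of_nonneg_right this hD.le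
      _ = _ := by ring

lemma isDecaying : IsDecaying S.q where
  rapid m := by
    obtain ⟨c, hc, k, hk, h⟩ := S.exists_exp_le_norm_D
    have h1 : Tendsto (fun x : ℝ => |x|) (cocompact ℝ) atTop := tendsto_norm_cocompact_atTop
    set C := ‖S.l ^ 2 - S.L ^ 2‖ * ‖S.n‖ / ‖S.l * S.L‖ with hC
    have h2 : Tendsto (fun x : ℝ => C / c / k ^ m * ((k * |x|) ^ m * Real.exp (-(k * |x|))))
        (cocompact ℝ) (𝓝 (C / c / k ^ m * 0)) :=
      (((Real.tendsto_pow_mul_exp_neg_atTop_nhds_zero m).comp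
        (h1.const_mul_atTop hk))).const_mul _
    rw [mul_zero] at h2
    refine squeeze_zero (fun x => by positivity) (fun x => ?_) h2
    have h3 : ‖S.q x‖ ≤ C / (c * Real.exp (k * |x|)) := by
      rw [S.norm_q]
      exact div_le_div_of_nonneg_left (by positivity) (by positivity) (h x)
    refine (mul_le_mul_of_nonneg_left h3 (by positivity)).trans (le_of_eq ?_)
    rw [Real.exp_neg, mul_pow]
    field_simp
  deriv_L1 := by rw [S.deriv_q]; exact S.memLp_u_one
  deriv_L3 := by rw [S.deriv_q]; exact S.memLp_u_three
  deriv2_L1 := by rw [S.deriv_q]; exact memLp_one_iff_integrable.2 S.integrable_deriv_u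

lemma tendsto_q_cocompact : Tendsto S.q (cocompact ℝ) (𝓝 0) := by
  have := S.isDecaying.rapid 0
  simp only [pow_zero, one_mul] at this
  exact tendsto_zero_iff_norm_tendsto_zero.2 this

lemma tendsto_q_atTop : Tendsto S.q atTop (𝓝 0) :=
  S.tendsto_q_cocompact.mono_left atTop_le_cocompact

lemma tendsto_q_atBot : Tendsto S.q atBot (𝓝 0) :=
  S.tendsto_q_cocompact.mono_left atBot_le_cocompact

lemma tendsto_qc_atTop : Tendsto S.qc atTop (𝓝 0) := by
  have := (Complex.continuous_conj.tendsto 0).comp S.tendsto_q_atTop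
  rw [map_zero] at this
  exact this.congr S.conj_q

lemma tendsto_qc_atBot : Tendsto S.qc atBot (𝓝 0) := by
  have := (Complex.continuous_conj.tendsto 0).comp S.tendsto_q_atBot
  rw [map_zero] at this
  exact this.congr S.conj_q

lemma tendsto_B_div_A : Tendsto (fun x => ((S.B x / S.A x : ℝ) : ℂ)) atTop (𝓝 0) := by
  have h : ∀ x, S.B x / S.A x = ‖S.n‖ ^ 2 / S.a ^ 2 * Real.exp (-(8 * S.xi * S.eta * x)) := by
    intro x
    have := S.a_pos.ne'
    have e : Real.exp (-(8 * S.xi * S.eta * x)) = Real.exp (-(4 * S.xi * S.eta * x))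
        / Real.exp (4 * S.xi * S.eta * x) := by
      rw [← Real.exp_sub]; congr 1; ring
    rw [e, A, B]
    field_simp
  have hk : 0 < 8 * S.xi * S.eta := mul_pos (mul_pos (by norm_num) S.xi_pos) S.eta_pos
  have := (Real.tendsto_exp_neg_atTop_nhds_zero.comp
    (tendsto_id.const_mul_atTop hk)).const_mul (‖S.n‖ ^ 2 / S.a ^ 2)
  rw [mul_zero] at this
  rw [← Complex.ofReal_zero]
  exact (Complex.continuous_ofReal.tendsto 0).comp (this.congr fun x => (h x).symm)

lemma tendsto_A_div_B : Tendsto (fun x => ((S.A x / S.B x : ℝ) : ℂ)) atBot (𝓝 0) := by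
  have h : ∀ x, S.A x / S.B x = S.a ^ 2 / ‖S.n‖ ^ 2 * Real.exp (8 * S.xi * S.eta * x) := by
    intro x
    have := S.a_pos.ne'
    have := S.norm_n_pos.ne'
    have e : Real.exp (8 * S.xi * S.eta * x) = Real.exp (4 * S.xi * S.eta * x)
        / Real.exp (-(4 * S.xi * S.eta * x)) := by
      rw [← Real.exp_sub]; congr 1; ring
    rw [e, A, B]
    field_simp
  have hk : 0 < 8 * S.xi * S.eta := mul_pos (mul_pos (by norm_num) S.xi_pos) S.eta_pos
  have := (Real.tendsto_exp_atBot.comp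
    (tendsto_id.const_mul_atBot hk)).const_mul (S.a ^ 2 / ‖S.n‖ ^ 2)
  rw [mul_zero] at this
  rw [← Complex.ofReal_zero]
  exact (Complex.continuous_ofReal.tendsto 0).comp (this.congr fun x => (h x).symm)

/-- As `x → ∞` the terms with `A` dominate in a fraction linear in `A` and `B`. -/
lemma tendsto_ratio_atTop (b c d e : ℂ) (hd : d ≠ 0) :
    Tendsto (fun x => (b * S.A x + c * S.B x) / (d * S.A x + e * S.B x)) atTop (𝓝 (b / d)) := by
  have h := S.tendsto_B_div_A
  have h1 : Tendsto (fun x => (b + c * ((S.B x / S.A x : ℝ) : ℂ))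
      / (d + e * ((S.B x / S.A x : ℝ) : ℂ))) atTop (𝓝 ((b + c * 0) / (d + e * 0))) :=
    ((h.const_mul c).const_add b).div ((h.const_mul e).const_add d) (by simpa using hd)
  simp only [mul_zero, add_zero] at h1
  refine h1.congr fun x => ?_
  have hA : (S.A x : ℂ) ≠ 0 := by exact_mod_cast (S.A_pos x).ne'
  rw [← mul_div_mul_right _ _ hA]
  push_cast
  congr 1 <;> field_simp

/-- As `x → -∞` the terms with `B` dominate in a fraction linear in `A` and `B`. -/
lemma tendsto_ratio_atBot (b c d e : ℂ) (he : e ≠ 0) :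
    Tendsto (fun x => (b * S.A x + c * S.B x) / (d * S.A x + e * S.B x)) atBot (𝓝 (c / e)) := by
  have h := S.tendsto_A_div_B
  have h1 : Tendsto (fun x => (b * ((S.A x / S.B x : ℝ) : ℂ) + c)
      / (d * ((S.A x / S.B x : ℝ) : ℂ) + e)) atBot (𝓝 ((b * 0 + c) / (d * 0 + e))) :=
    ((h.const_mul b).add_const c).div ((h.const_mul d).add_const e) (by simpa using he)
  simp only [mul_zero, zero_add] at h1
  refine h1.congr fun x => ?_
  have hB : (S.B x : ℂ) ≠ 0 := by exact_mod_cast (S.B_pos x).ne'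
  rw [← mul_div_mul_right _ _ hB]
  push_cast
  congr 1 <;> field_simp

lemma tendsto_T11_atTop (g : ℂ) : Tendsto (S.T11 g) atTop (𝓝 (1 - g / S.l ^ 2)) := by
  have hl := S.l_ne
  have hL := S.L_ne
  have := ((S.tendsto_ratio_atTop S.L S.l S.l S.L hl).const_mul (g / (S.l * S.L))).const_sub 1
  convert this using 2
  · rename_i x
    simp only [T11, E, D]
    rw [div_mul_div_comm]
  · field_simp

lemma tendsto_T11_atBot (g : ℂ) : Tendsto (S.T11 g) atBot (𝓝 (1 - g / S.L ^ 2)) := by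
  have hl := S.l_ne
  have hL := S.L_ne
  have := ((S.tendsto_ratio_atBot S.L S.l S.l S.L hL).const_mul (g / (S.l * S.L))).const_sub 1
  convert this using 2
  · rename_i x
    simp only [T11, E, D]
    rw [div_mul_div_comm]
  · field_simp

lemma tendsto_T22_atTop (g : ℂ) : Tendsto (S.T22 g) atTop (𝓝 (1 - g / S.L ^ 2)) := by
  have hl := S.l_ne
  have hL := S.L_ne
  have := ((S.tendsto_ratio_atTop S.l S.L S.L S.l hL).const_mul (g / (S.l * S.L))).const_sub 1
  convert this using 2
  · rename_i x
    simp only [T22, E, D]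
    rw [div_mul_div_comm]
  · field_simp

lemma tendsto_T22_atBot (g : ℂ) : Tendsto (S.T22 g) atBot (𝓝 (1 - g / S.l ^ 2)) := by
  have hl := S.l_ne
  have hL := S.L_ne
  have := ((S.tendsto_ratio_atBot S.l S.L S.L S.l hl).const_mul (g / (S.l * S.L))).const_sub 1
  convert this using 2
  · rename_i x
    simp only [T22, E, D]
    rw [div_mul_div_comm]
  · field_simp

/-! ### Jost functions and scattering coefficients -/

/-- The Jost functions of the soliton. -/
def jost : Columns where
  m1 z x := (1 - z ^ 2 / S.L ^ 2)⁻¹ • S.col1 z x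
  m2 z x := (1 - z ^ 2 / S.l ^ 2)⁻¹ • S.col2 z x
  p1 z x := (1 - z ^ 2 / S.l ^ 2)⁻¹ • S.col1 z x
  p2 z x := (1 - z ^ 2 / S.L ^ 2)⁻¹ • S.col2 z x

/-- The first scattering coefficient of the soliton. -/
def s11 (z : ℂ) : ℂ := (1 - z ^ 2 / S.l ^ 2) * (1 - z ^ 2 / S.L ^ 2)⁻¹

/-- The second scattering coefficient of the soliton. -/
def s22 (z : ℂ) : ℂ := (1 - z ^ 2 / S.L ^ 2) * (1 - z ^ 2 / S.l ^ 2)⁻¹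

lemma one_sub_div_l_ne {g : ℂ} (hg : g.im ≤ 0) : 1 - g / S.l ^ 2 ≠ 0 := by
  intro h
  have h1 : g = S.l ^ 2 := by
    exact (div_eq_one_iff_eq (pow_ne_zero 2 S.l_ne)).1 (sub_eq_zero.1 h).symm
  rw [h1] at hg
  exact absurd S.l_sq_im_pos (not_lt.2 hg)

lemma one_sub_div_L_ne {g : ℂ} (hg : 0 ≤ g.im) : 1 - g / S.L ^ 2 ≠ 0 := by
  intro h
  have h1 : g = S.L ^ 2 := by
    exact (div_eq_one_iff_eq (pow_ne_zero 2 S.L_ne)).1 (sub_eq_zero.1 h).symm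
  rw [h1] at hg
  exact absurd S.L_sq_im_neg (not_lt.2 hg)

lemma tendsto_col1 {F : Filter ℝ} {z k : ℂ} (hk : k ≠ 0) (h : Tendsto (S.T11 (z ^ 2)) F (𝓝 k))
    (hq : Tendsto S.qc F (𝓝 0)) :
    Tendsto (fun x : ℝ => Complex.exp (Complex.I * z ^ 2 * x) • (k⁻¹ • S.col1 z x)) F
      (𝓝 ![1, 0]) := by
  have e (x : ℝ) : Complex.exp (Complex.I * z ^ 2 * x) * Complex.exp (-Complex.I * z ^ 2 * x)
      = 1 := by
    rw [← Complex.exp_add, ← Complex.exp_zero]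
    congr 1; ring
  rw [tendsto_pi_nhds]
  intro i
  fin_cases i
  · have := h.const_mul k⁻¹
    rw [inv_mul_cancel₀ hk] at this
    refine this.congr fun x => ?_
    simp only [col1, Pi.smul_apply, smul_eq_mul, Fin.zero_eta, Matrix.cons_val_zero]
    linear_combination (-(k⁻¹ * S.T11 (z ^ 2) x)) * e x
  · have := hq.const_mul (k⁻¹ * -z)
    rw [mul_zero] at this
    refine this.congr fun x => ?_
    simp only [col1, Pi.smul_apply, smul_eq_mul, Fin.mk_one, Matrix.cons_val_one,
      Matrix.cons_val_fin_one]
    linear_combination (k⁻¹ * z * S.qc x) * e x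

lemma tendsto_col2 {F : Filter ℝ} {z k : ℂ} (hk : k ≠ 0) (h : Tendsto (S.T22 (z ^ 2)) F (𝓝 k))
    (hq : Tendsto S.q F (𝓝 0)) :
    Tendsto (fun x : ℝ => Complex.exp (-(Complex.I * z ^ 2 * x)) • (k⁻¹ • S.col2 z x)) F
      (𝓝 ![0, 1]) := by
  have e (x : ℝ) : Complex.exp (-(Complex.I * z ^ 2 * x)) * Complex.exp (Complex.I * z ^ 2 * x)
      = 1 := by
    rw [← Complex.exp_add, ← Complex.exp_zero]
    congr 1; ring
  rw [tendsto_pi_nhds]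
  intro i
  fin_cases i
  · have := hq.const_mul (k⁻¹ * z)
    rw [mul_zero] at this
    refine this.congr fun x => ?_
    simp only [col2, Pi.smul_apply, smul_eq_mul, Fin.zero_eta, Matrix.cons_val_zero]
    linear_combination (-(k⁻¹ * z * S.q x)) * e x
  · have := h.const_mul k⁻¹
    rw [inv_mul_cancel₀ hk] at this
    refine this.congr fun x => ?_
    simp only [col2, Pi.smul_apply, smul_eq_mul, Fin.mk_one, Matrix.cons_val_one,
      Matrix.cons_val_fin_one]
    linear_combination (-(k⁻¹ * S.T22 (z ^ 2) x)) * e x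

lemma isJost : IsJost S.u S.jost where
  m1_wave z _ := isWave_smul (S.isWave_col1 z) _
  p2_wave z _ := isWave_smul (S.isWave_col2 z) _
  p1_wave z _ := isWave_smul (S.isWave_col1 z) _
  m2_wave z _ := isWave_smul (S.isWave_col2 z) _
  m1_lim _ hz := S.tendsto_col1 (S.one_sub_div_L_ne hz) (S.tendsto_T11_atBot _) S.tendsto_qc_atBot
  p2_lim _ hz := S.tendsto_col2 (S.one_sub_div_L_ne hz) (S.tendsto_T22_atTop _) S.tendsto_q_atTop
  p1_lim _ hz := S.tendsto_col1 (S.one_sub_div_l_ne hz) (S.tendsto_T11_atTop _) S.tendsto_qc_atTop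
  m2_lim _ hz := S.tendsto_col2 (S.one_sub_div_l_ne hz) (S.tendsto_T22_atBot _) S.tendsto_q_atBot

lemma colDet_smul (c d : ℂ) (v w : Fin 2 → ℂ) :
    colDet (c • v) (d • w) = c * d * colDet v w := by
  simp only [colDet, Matrix.det_fin_two_of, Pi.smul_apply, smul_eq_mul]
  ring

lemma isScattering : IsScattering S.jost S.s11 S.s22 where
  s11_eq z hz x := by
    have := S.one_sub_div_L_ne hz
    simp only [jost, colDet_smul, S.colDet_col, s11]
    field_simp
  s22_eq z hz x := by
    have := S.one_sub_div_l_ne hz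
    simp only [jost, colDet_smul, S.colDet_col, s22]
    field_simp

lemma eq_or_eq_neg_of_one_sub_div {z c : ℂ} (hc : c ≠ 0) (h : 1 - z ^ 2 / c ^ 2 = 0) :
    z = c ∨ z = -c := by
  rw [← sq_eq_sq_iff_eq_or_eq_neg]
  field_simp at h
  linear_combination -h

lemma deriv_ratio_ne {a b z : ℂ} (ha : a ≠ 0) (hb : 1 - z ^ 2 / b ^ 2 ≠ 0) (hz : z ^ 2 = a ^ 2) :
    deriv (fun w : ℂ => (1 - w ^ 2 / a ^ 2) * (1 - w ^ 2 / b ^ 2)⁻¹) z ≠ 0 := by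
  have h1 (c : ℂ) : HasDerivAt (fun w : ℂ => 1 - w ^ 2 / c ^ 2) (-(2 * z / c ^ 2)) z := by
    have := ((hasDerivAt_pow 2 z).div_const (c ^ 2)).const_sub 1
    simpa using this
  have hz0 : z ≠ 0 := by
    rintro rfl
    exact ha (by simpa using hz.symm)
  have h0 : 1 - z ^ 2 / a ^ 2 = 0 := by rw [hz, div_self (pow_ne_zero 2 ha), sub_self]
  have h2 : HasDerivAt (fun w : ℂ => (1 - w ^ 2 / a ^ 2) * (1 - w ^ 2 / b ^ 2)⁻¹) _ z :=
    (h1 a).mul ((h1 b).inv hb)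
  rw [h2.deriv, h0, zero_mul, add_zero]
  simp [hz0, ha, hb]

lemma isDiscreteSpectrum :
    IsDiscreteSpectrum S.s11 S.s22 {S.l, -S.l} {S.L, -S.L} where
  mem_L1 z := by
    simp only [Finset.mem_insert, Finset.mem_singleton]
    constructor
    · intro h
      have h2 : z ^ 2 = S.l ^ 2 := by rcases h with rfl | rfl <;> ring
      refine ⟨by rw [h2]; exact S.l_sq_im_pos, ?_⟩
      rw [s11, h2, div_self (pow_ne_zero 2 S.l_ne), sub_self, zero_mul]
    · rintro ⟨h1, h2⟩
      refine eq_or_eq_neg_of_one_sub_div S.l_ne ?_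
      exact (mul_eq_zero.1 h2).resolve_right (inv_ne_zero (S.one_sub_div_L_ne h1.le))
  mem_L2 z := by
    simp only [Finset.mem_insert, Finset.mem_singleton]
    constructor
    · intro h
      have h2 : z ^ 2 = S.L ^ 2 := by rcases h with rfl | rfl <;> ring
      refine ⟨by rw [h2]; exact S.L_sq_im_neg, ?_⟩
      rw [s22, h2, div_self (pow_ne_zero 2 S.L_ne), sub_self, zero_mul]
    · rintro ⟨h1, h2⟩
      refine eq_or_eq_neg_of_one_sub_div S.L_ne ?_
      exact (mul_eq_zero.1 h2).resolve_right (inv_ne_zero (S.one_sub_div_l_ne h1.le))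
  simple_L1 z hz := by
    have h2 : z ^ 2 = S.l ^ 2 := by
      rw [Finset.mem_insert, Finset.mem_singleton] at hz
      rcases hz with rfl | rfl <;> ring
    exact deriv_ratio_ne S.l_ne (S.one_sub_div_L_ne (by rw [h2]; exact S.l_sq_im_pos.le)) h2
  simple_L2 z hz := by
    have h2 : z ^ 2 = S.L ^ 2 := by
      rw [Finset.mem_insert, Finset.mem_singleton] at hz
      rcases hz with rfl | rfl <;> ring
    exact deriv_ratio_ne S.L_ne (S.one_sub_div_l_ne (by rw [h2]; exact S.L_sq_im_neg.le)) h2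
  s11_ne z hz := mul_ne_zero (S.one_sub_div_l_ne hz.le)
    (inv_ne_zero (S.one_sub_div_L_ne hz.ge))
  s22_ne z hz := mul_ne_zero (S.one_sub_div_L_ne hz.ge)
    (inv_ne_zero (S.one_sub_div_l_ne hz.le))

end Soliton

/-! ### Contour integrals with a non-holomorphic weight -/

/-- The Wirtinger derivative `∂/∂z` belonging to a real differential. -/
def wirtinger (T : ℂ →L[ℝ] ℂ) : ℂ := (T 1 - Complex.I * T Complex.I) / 2

/-- The Wirtinger derivative `∂/∂z̄` belonging to a real differential. -/
def wirtingerBar (T : ℂ →L[ℝ] ℂ) : ℂ := (T 1 + Complex.I * T Complex.I) / 2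

lemma apply_eq_wirtinger (T : ℂ →L[ℝ] ℂ) (v : ℂ) :
    T v = wirtinger T * v + wirtingerBar T * (starRingEnd ℂ) v := by
  have hv : T v = v.re * T 1 + v.im * T Complex.I := by
    conv_lhs => rw [← Complex.re_add_im v]
    have e1 : (v.re : ℂ) = v.re • (1 : ℂ) := by simp
    have e2 : (v.im : ℂ) * Complex.I = v.im • Complex.I := by simp
    rw [e1, e2, map_add, map_smul, map_smul]
    simp
  have h1 : (v.re : ℂ) = (v + (starRingEnd ℂ) v) / 2 := Complex.re_eq_add_conj v
  have h2 : (v.im : ℂ) = (v - (starRingEnd ℂ) v) / (2 * Complex.I) := Complex.im_eq_sub_conj v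
  rw [hv, h1, h2, wirtinger, wirtingerBar]
  have := Complex.I_ne_zero
  field_simp
  linear_combination (T Complex.I * (v - (starRingEnd ℂ) v)) * Complex.I_sq

lemma eventually_forall_sphere {p : ℂ → Prop} {a : ℂ} (h : ∀ᶠ z in 𝓝[≠] a, p z) :
    ∀ᶠ r : ℝ in 𝓝[>] 0, ∀ z ∈ Metric.sphere a r, p z := by
  rw [eventually_nhdsWithin_iff, Metric.eventually_nhds_iff] at h
  obtain ⟨ρ, hρ, h⟩ := h
  filter_upwards [Ioo_mem_nhdsGT hρ] with r hr z hz
  rw [Metric.mem_sphere] at hz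
  refine h (by rw [hz]; exact hr.2) ?_
  rintro rfl
  rw [dist_self] at hz
  exact hr.1.ne hz

/-- The integral of a real affine function divided by `(z - a)²` over a circle about `a`: the
antiholomorphic part does not contribute, as `conj (z - a) = r² / (z - a)` on the circle. -/
lemma circleIntegral_affine_div_sq (a c α β : ℂ) {r : ℝ} (hr : 0 < r) :
    (∮ z in C(a, r), (c + (α * (z - a) + β * (starRingEnd ℂ) (z - a))) / (z - a) ^ 2)
      = 2 * Real.pi * Complex.I * α := by
  have hne (z : ℂ) (hz : z ∈ Metric.sphere a r) : z - a ≠ 0 := by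
    rw [mem_sphere_iff_norm] at hz
    rw [← norm_pos_iff, hz]; exact hr
  have hci (m : ℤ) (k : ℂ) : CircleIntegrable (fun z => k * (z - a) ^ m) a r := by
    refine ContinuousOn.circleIntegrable hr.le ?_
    exact continuousOn_const.mul
      ((continuousOn_id.sub continuousOn_const).zpow₀ m fun z hz => Or.inl (hne z hz))
  have h0 : (∮ z in C(a, r), (c + (α * (z - a) + β * (starRingEnd ℂ) (z - a))) / (z - a) ^ 2)
      = ∮ z in C(a, r), (c * (z - a) ^ (-2 : ℤ) + α * (z - a) ^ (-1 : ℤ))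
        + (β * r ^ 2) * (z - a) ^ (-3 : ℤ) := by
    refine circleIntegral.integral_congr hr.le fun z hz => ?_
    have h1 := hne z hz
    have h2 : (z - a) * (starRingEnd ℂ) (z - a) = (r : ℂ) ^ 2 := by
      rw [mem_sphere_iff_norm] at hz
      rw [Complex.mul_conj, Complex.normSq_eq_norm_sq, hz]
      push_cast; rfl
    have e1 : (z - a) ^ (-2 : ℤ) = ((z - a) ^ 2)⁻¹ := by rw [zpow_neg]; rfl
    have e2 : (z - a) ^ (-3 : ℤ) = ((z - a) ^ 3)⁻¹ := by rw [zpow_neg]; rfl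
    simp only [e1, e2, zpow_neg_one]
    rw [← h2]
    field_simp
    ring
  have hadd : CircleIntegrable (fun z => c * (z - a) ^ (-2 : ℤ) + α * (z - a) ^ (-1 : ℤ)) a r :=
    (hci _ _).add (hci _ _)
  rw [h0, circleIntegral.integral_add hadd (hci _ _), circleIntegral.integral_add (hci _ _) (hci _ _),
    circleIntegral.integral_const_mul, circleIntegral.integral_const_mul,
    circleIntegral.integral_const_mul,
    circleIntegral.integral_sub_zpow_of_ne (n := -2) (by norm_num),
    circleIntegral.integral_sub_zpow_of_ne (n := -3) (by norm_num)]
  simp only [zpow_neg_one, circleIntegral.integral_sub_center_inv a hr.ne']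
  ring

/-- A second order pole with a numerator that is only differentiable in the real sense: the
integrals over small circles converge, and the limit sees only the Wirtinger derivative `∂/∂z` of
the numerator. -/
lemma hasCircleLimit_of_hasFDerivAt {K G : ℂ → ℂ} {a : ℂ} {G' : ℂ →L[ℝ] ℂ}
    (hG : HasFDerivAt G G' a) (hc : ∀ᶠ z in 𝓝 a, ContinuousAt G z)
    (hK : ∀ᶠ z in 𝓝[≠] a, K z = G z / (z - a) ^ 2) :
    HasCircleLimit K a (2 * Real.pi * Complex.I * wirtinger G') := by
  have hne {r : ℝ} (hr : 0 < r) (z : ℂ) (hz : z ∈ Metric.sphere a r) : z - a ≠ 0 := by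
    rw [mem_sphere_iff_norm] at hz
    rw [← norm_pos_iff, hz]; exact hr
  have hcs := eventually_forall_sphere (hc.filter_mono nhdsWithin_le_nhds)
  have hKs := eventually_forall_sphere hK
  have hint : ∀ᶠ r : ℝ in 𝓝[>] 0, CircleIntegrable (fun z => G z / (z - a) ^ 2) a r := by
    filter_upwards [hcs, self_mem_nhdsWithin] with r h1 hr
    refine ContinuousOn.circleIntegrable (le_of_lt hr) ?_
    refine ContinuousOn.div (fun z hz => (h1 z hz).continuousWithinAt)
      ((continuousOn_id.sub continuousOn_const).pow 2) fun z hz => pow_ne_zero 2 (hne hr z hz)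
  have haff {r : ℝ} (hr : 0 < r) : CircleIntegrable
      (fun z => (G a + (wirtinger G' * (z - a) + wirtingerBar G' * (starRingEnd ℂ) (z - a)))
        / (z - a) ^ 2) a r := by
    refine ContinuousOn.circleIntegrable (le_of_lt hr) ?_
    refine ContinuousOn.div ?_
      ((continuousOn_id.sub continuousOn_const).pow 2) fun z hz => pow_ne_zero 2 (hne hr z hz)
    have := Complex.continuous_conj
    exact Continuous.continuousOn (by fun_prop)
  refine ⟨?_, ?_⟩
  · filter_upwards [hint, hKs, self_mem_nhdsWithin] with r h1 h2 hr
    refine h1.congr fun θ _ => ?_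
    exact (h2 _ (circleMap_mem_sphere a (le_of_lt hr) θ)).symm
  · rw [Metric.tendsto_nhds]
    intro δ hδ
    have h3 := hG.isLittleO.def (show 0 < δ / (4 * Real.pi) by positivity)
    have h3s := eventually_forall_sphere (h3.filter_mono nhdsWithin_le_nhds)
    filter_upwards [hint, hKs, h3s, self_mem_nhdsWithin] with r h1 h2 h3 hr
    have hr' : 0 < r := hr
    rw [circleIntegral.integral_congr hr'.le (fun z hz => h2 z hz),
      ← circleIntegral_affine_div_sq a (G a) (wirtinger G') (wirtingerBar G') hr', dist_eq_norm,
      ← circleIntegral.integral_sub h1 (haff hr')]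
    have hb : ∀ z ∈ Metric.sphere a r, ‖G z / (z - a) ^ 2
        - (G a + (wirtinger G' * (z - a) + wirtingerBar G' * (starRingEnd ℂ) (z - a)))
          / (z - a) ^ 2‖ ≤ δ / (4 * Real.pi) / r := by
      intro z hz
      have h4 := h3 z hz
      rw [apply_eq_wirtinger] at h4
      have h5 := mem_sphere_iff_norm.1 hz
      rw [← sub_div, norm_div, norm_pow, h5, div_le_div_iff₀ (by positivity) hr']
      rw [h5, sub_sub] at h4
      calc _ ≤ δ / (4 * Real.pi) * r * r := mul_le_mul_of_nonneg_right h4 hr'.le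
        _ = _ := by ring
    refine (circleIntegral.norm_integral_le_of_norm_le_const hr'.le hb).trans_lt ?_
    have : 2 * Real.pi * r * (δ / (4 * Real.pi) / r) = δ / 2 := by
      field_simp
      norm_num
    rw [this]
    linarith

/-- The weight `|2 z²|^(2 eps)`. -/
def weight (eps : ℝ) (z : ℂ) : ℂ := ((‖2 * z ^ 2‖ ^ (2 * eps) : ℝ) : ℂ)

lemma differentiableAt_weight (eps : ℝ) {z : ℂ} (hz : z ≠ 0) :
    DifferentiableAt ℝ (weight eps) z := by
  have h1 : DifferentiableAt ℝ (fun w : ℂ => 2 * w ^ 2) z := by fun_prop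
  have h0 : 2 * z ^ 2 ≠ 0 := by simp [hz]
  have h2 : DifferentiableAt ℝ (fun w : ℂ => ‖2 * w ^ 2‖) z := h1.norm ℝ h0
  have h3 := h2.rpow_const (p := 2 * eps) (Or.inl (norm_ne_zero_iff.2 h0))
  exact (Complex.ofRealCLM.differentiableAt.comp z h3 :)

lemma weight_eq_of_sq_eq (eps : ℝ) {z w : ℂ} (h : z ^ 2 = w ^ 2) : weight eps z = weight eps w := by
  rw [weight, weight, h]

/-- The contribution of a point `b` of the discrete spectrum.  As `∫ Y(b², ·) = 0`, neither the
derivative of the weight nor that of `P` enters the result. -/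
lemma exists_hasCircleLimit {eps : ℝ} {b I1 : ℂ} (hb : b ≠ 0) {P : ℂ → ℂ} {Y : ℂ → ℝ → ℂ}
    {Y1 : ℝ → ℂ} {K : ℂ → ℝ → ℂ} (hP : ∀ᶠ g in 𝓝 (b ^ 2), DifferentiableAt ℂ P g)
    (hY : ∀ y, Differentiable ℂ fun g => Y g y)
    (hY1 : ∀ y, HasDerivAt (fun g => Y g y) (Y1 y) (b ^ 2))
    (hK : ∀ᶠ z in 𝓝 b, ∀ y, K z y
      = weight eps z / (z ^ 3 * (1 - z ^ 2 / b ^ 2) ^ 2) * P (z ^ 2) * Y (z ^ 2) y)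
    (hYint : Integrable (Y (b ^ 2))) (hY0 : ∫ y, Y (b ^ 2) y = 0)
    (hY1int : Integrable Y1) (hI1 : ∫ y, Y1 y = I1) :
    ∃ c : ℝ → ℂ, (∀ y, HasCircleLimit (fun z => K z y) b (c y)) ∧ Integrable c ∧
      ∫ y, c y = Real.pi * Complex.I * weight eps b * P (b ^ 2) * I1 := by
  set F : ℂ → ℂ := fun z => weight eps z * (b ^ 4 / (z ^ 3 * (z + b) ^ 2) * P (z ^ 2)) with hF
  have hb2 : b + b ≠ 0 := by
    rw [← two_mul]; simp [hb]
  have hne : ∀ᶠ z in 𝓝 b, z ≠ 0 ∧ z + b ≠ 0 :=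
    (continuousAt_id.eventually_ne hb).and
      ((continuousAt_id.add continuousAt_const).eventually_ne hb2)
  have hsq : Tendsto (fun z : ℂ => z ^ 2) (𝓝 b) (𝓝 (b ^ 2)) := (continuous_pow 2).tendsto b
  have hFd : ∀ᶠ z in 𝓝 b, DifferentiableAt ℝ F z := by
    filter_upwards [hne, hsq.eventually hP] with z hz hz2
    have h1 : DifferentiableAt ℂ (fun z => b ^ 4 / (z ^ 3 * (z + b) ^ 2) * P (z ^ 2)) z := by
      refine DifferentiableAt.mul (DifferentiableAt.div (by fun_prop) (by fun_prop) ?_)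
        (DifferentiableAt.comp z hz2 (by fun_prop))
      exact mul_ne_zero (pow_ne_zero 3 hz.1) (pow_ne_zero 2 hz.2)
    exact (differentiableAt_weight eps hz.1).mul (h1.restrictScalars ℝ)
  have hYd (y : ℝ) : Differentiable ℂ fun z : ℂ => Y (z ^ 2) y := by
    have h2 : Differentiable ℂ fun z : ℂ => z ^ 2 := by fun_prop
    exact (hY y).comp h2
  set F' := fderiv ℝ F b with hF'
  have hFb : HasFDerivAt F F' b := hFd.self_of_nhds.hasFDerivAt
  have hYb (y : ℝ) : HasDerivAt (fun z : ℂ => Y (z ^ 2) y) (Y1 y * (2 * b)) b := by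
    have : HasDerivAt (fun z : ℂ => Y (z ^ 2) y) _ b :=
      HasDerivAt.comp (h₂ := fun g => Y g y) b (hY1 y) (hasDerivAt_pow 2 b)
    refine this.congr_deriv ?_
    simp
  refine ⟨fun y => 2 * Real.pi * Complex.I
    * (wirtinger F' * Y (b ^ 2) y + 2 * b * F b * Y1 y), fun y => ?_, ?_, ?_⟩
  · have h1 := hFb.mul ((hYb y).hasFDerivAt.restrictScalars ℝ)
    have h2 : ∀ᶠ z in 𝓝 b, ContinuousAt (F * fun z : ℂ => Y (z ^ 2) y) z := by
      filter_upwards [hFd] with z hz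
      exact hz.continuousAt.mul (hYd y z).continuousAt
    have h3 := hasCircleLimit_of_hasFDerivAt (K := fun z => K z y) h1 h2 ?_
    · convert h3 using 2
      simp [wirtinger]
      linear_combination (b * F b * Y1 y) * Complex.I_sq
    · rw [eventually_nhdsWithin_iff]
      filter_upwards [hK, hne] with z hz hz2 hzb
      have h4 : z - b ≠ 0 := sub_ne_zero.2 hzb
      have h5 : 1 - z ^ 2 / b ^ 2 = -((z - b) * (z + b) / b ^ 2) := by field_simp; ring
      rw [hz y, h5]
      simp only [hF, Pi.mul_apply]
      have := hz2.1
      have := hz2.2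
      field_simp
  · exact ((hYint.const_mul _).add (hY1int.const_mul _)).const_mul _
  · rw [integral_const_mul, integral_add (hYint.const_mul _) (hY1int.const_mul _),
      integral_const_mul, integral_const_mul, hY0, hI1]
    simp only [hF]
    field_simp
    ring

/-- The integral over the drawn-in contour when the part along `Σ` vanishes and the discrete
spectrum is `{b, -b}`. -/
lemma hasGammaIntegral_of_reflectionless {eps : ℝ} {b I1 orient : ℂ} (hb : b ≠ 0) {P : ℂ → ℂ}
    {Y : ℂ → ℝ → ℂ} {Y1 : ℝ → ℂ} {K : ℂ → ℝ → ℂ}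
    (hP : ∀ᶠ g in 𝓝 (b ^ 2), DifferentiableAt ℂ P g)
    (hY : ∀ y, Differentiable ℂ fun g => Y g y)
    (hY1 : ∀ y, HasDerivAt (fun g => Y g y) (Y1 y) (b ^ 2))
    (hK : ∀ᶠ g in 𝓝 (b ^ 2), ∀ z : ℂ, z ^ 2 = g → ∀ y, K z y
      = weight eps z / (z ^ 3 * (1 - z ^ 2 / b ^ 2) ^ 2) * P (z ^ 2) * Y (z ^ 2) y)
    (hYint : Integrable (Y (b ^ 2))) (hY0 : ∫ y, Y (b ^ 2) y = 0)
    (hY1int : Integrable Y1) (hI1 : ∫ y, Y1 y = I1)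
    (hsigma : ∀ z : ℂ, z ≠ 0 → (z ^ 2).im = 0 → Integrable (K z) ∧ ∫ y, K z y = 0) :
    HasGammaIntegral orient {b, -b} K
      (orient * (2 * Real.pi * Complex.I * weight eps b * P (b ^ 2) * I1)) := by
  have hmem (d : ℂ) (hd : d = 1 ∨ d = -1 ∨ d = Complex.I ∨ d = -Complex.I) (s : ℝ) (hs : 0 < s) :
      Integrable (K (d * s)) ∧ ∫ y, K (d * s) y = 0 := by
    have hs' : (s : ℂ) ≠ 0 := by exact_mod_cast hs.ne'
    have hi := Complex.I_ne_zero
    refine hsigma _ ?_ ?_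
    · rcases hd with rfl | rfl | rfl | rfl <;> simp [hs']
    · have : (d * (s : ℂ)) ^ 2 = ((s ^ 2 : ℝ) : ℂ) ∨ (d * (s : ℂ)) ^ 2 = ((-s ^ 2 : ℝ) : ℂ) := by
        rcases hd with rfl | rfl | rfl | rfl <;> simp [mul_pow]
      rcases this with h | h <;> rw [h, Complex.ofReal_im]
  have hpt (b' : ℂ) (hb' : b' ^ 2 = b ^ 2) : ∃ c : ℝ → ℂ,
      (∀ y, HasCircleLimit (fun z => K z y) b' (c y)) ∧ Integrable c ∧
      ∫ y, c y = Real.pi * Complex.I * weight eps b * P (b ^ 2) * I1 := by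
    have hb0 : b' ≠ 0 := by
      rintro rfl
      exact hb (by simpa using hb'.symm)
    have hsq : Tendsto (fun z : ℂ => z ^ 2) (𝓝 b') (𝓝 (b' ^ 2)) := (continuous_pow 2).tendsto b'
    rw [← weight_eq_of_sq_eq eps hb']
    rw [← hb'] at hP hY1 hK hYint hY0 ⊢
    exact exists_hasCircleLimit hb0 hP hY hY1 ((hsq.eventually hK).mono fun z hz => hz z rfl)
      hYint hY0 hY1int hI1
  obtain ⟨c1, h1, h2, h3⟩ := hpt b rfl
  obtain ⟨c2, h4, h5, h6⟩ := hpt (-b) (by ring)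
  have hbb : -b ≠ b := by
    intro h
    exact hb (self_eq_neg.1 h.symm)
  refine ⟨fun d hd => ⟨fun s hs => (hmem d hd s hs).1, ?_⟩,
    fun z => if z = b then c1 else c2, ?_, ?_, ?_⟩
  · refine integrableOn_zero.congr_fun (fun s hs => ?_) measurableSet_Ioi
    exact (hmem d hd s hs).2.symm
  · intro z hz y
    rw [Finset.mem_insert, Finset.mem_singleton] at hz
    rcases hz with rfl | rfl
    · simpa using h1 y
    · simpa [hbb] using h4 y
  · intro z hz
    rw [Finset.mem_insert, Finset.mem_singleton] at hz
    rcases hz with rfl | rfl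
    · simpa using h2
    · simpa [hbb] using h5
  · have h7 : sigmaIntegral (fun z => ∫ y : ℝ, K z y) = 0 := by
      rw [sigmaIntegral, setIntegral_congr_fun (g := fun _ => 0) measurableSet_Ioi ?_]
      · simp
      · intro s hs
        have e1 := (hmem 1 (by simp) s hs).2
        have e2 := (hmem (-1) (by simp) s hs).2
        have e3 := (hmem Complex.I (by simp) s hs).2
        have e4 := (hmem (-Complex.I) (by simp) s hs).2
        simp only [one_mul, neg_mul] at e1 e2 e3 e4
        simp only [e1, e2, e3, e4]
        ring
    rw [h7, Finset.sum_pair hbb.symm]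
    simp only [if_true, hbb, if_false, h3, h6]
    ring

namespace Soliton

variable (S : Soliton)

/-! ### The spatial integrals -/

/-- The quadratic expression `φ₁² u^* - φ₂² u` for the second column of the dressed wave matrix,
as a function of the squared spectral parameter. -/
def Y (g : ℂ) (y : ℝ) : ℂ :=
  Complex.exp (2 * Complex.I * g * y) * (g * S.q y ^ 2 * S.uc y - S.T22 g y ^ 2 * S.u y)

/-- The derivative of `Y` with respect to the squared spectral parameter. -/
def Y' (g : ℂ) (y : ℝ) : ℂ :=
  Complex.exp (2 * Complex.I * g * y) * (2 * Complex.I * y * (g * S.q y ^ 2 * S.uc y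
    - S.T22 g y ^ 2 * S.u y) + S.q y ^ 2 * S.uc y
    + 2 * S.T22 g y * S.u y * (S.D y / (S.l * S.L * S.E y)))

lemma T22_eq (g : ℂ) (y : ℝ) : S.T22 g y = 1 - g * (S.D y / (S.l * S.L * S.E y)) := by
  rw [T22, mul_div_assoc]

lemma T11_eq (g : ℂ) (y : ℝ) : S.T11 g y = 1 - g * (S.E y / (S.l * S.L * S.D y)) := by
  rw [T11, mul_div_assoc]

lemma hasDerivAt_T22_param (g : ℂ) (y : ℝ) :
    HasDerivAt (fun g => S.T22 g y) (-(S.D y / (S.l * S.L * S.E y))) g := by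
  simp only [T22_eq]
  have := ((hasDerivAt_id g).mul_const (S.D y / (S.l * S.L * S.E y))).const_sub 1
  simpa using this

lemma hasDerivAt_Y (g : ℂ) (y : ℝ) : HasDerivAt (fun g => S.Y g y) (S.Y' g y) g := by
  have h1 : HasDerivAt (fun g : ℂ => Complex.exp (2 * Complex.I * g * y))
      (Complex.exp (2 * Complex.I * g * y) * (2 * Complex.I * y)) g := by
    have := (((hasDerivAt_id g).const_mul (2 * Complex.I)).mul_const (y : ℂ)).cexp
    simpa using this
  have h2 : HasDerivAt (fun g : ℂ => g * S.q y ^ 2 * S.uc y - S.T22 g y ^ 2 * S.u y) _ g :=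
    (((hasDerivAt_id g).mul_const (S.q y ^ 2)).mul_const (S.uc y)).sub
      (((S.hasDerivAt_T22_param g y).pow 2).mul_const (S.u y))
  refine (h1.mul h2).congr_deriv ?_
  simp only [Y']
  push_cast
  ring

lemma hasDerivAt_exp (g : ℂ) (y : ℝ) :
    HasDerivAt (fun y : ℝ => Complex.exp (2 * Complex.I * g * y))
      (2 * Complex.I * g * Complex.exp (2 * Complex.I * g * y)) y :=
  hasDerivAt_cexp _ y

/-- The expression `Y` is a total derivative. -/
lemma hasDerivAt_primitive (g : ℂ) (y : ℝ) :
    HasDerivAt (fun y : ℝ => S.q y * S.T22 g y * Complex.exp (2 * Complex.I * g * y))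
      (-S.Y g y) y := by
  refine (((S.hasDerivAt_q y).mul (S.hasDerivAt_T22 g y)).mul (hasDerivAt_exp g y)).congr_deriv ?_
  have h := S.u_mul_T22 g y
  simp only [Y, Pi.mul_apply]
  linear_combination (-Complex.exp (2 * Complex.I * g * y) * S.T22 g y) * h

/-- The `g`-derivative of `Y` is a total derivative as well. -/
lemma hasDerivAt_primitive' (g : ℂ) (y : ℝ) :
    HasDerivAt (fun y : ℝ => 2 * Complex.I * y * (S.q y * S.T22 g y
        * Complex.exp (2 * Complex.I * g * y))
      - S.q y * (S.D y / (S.l * S.L * S.E y)) * Complex.exp (2 * Complex.I * g * y))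
      (-S.Y' g y) y := by
  have hk : HasDerivAt (fun y => S.D y / (S.l * S.L * S.E y)) (S.uc y * S.q y) y := by
    have := (S.hasDerivAt_T22 1 y).const_sub 1
    have e : (fun y => 1 - S.T22 1 y) = fun y => S.D y / (S.l * S.L * S.E y) := by
      funext y; rw [T22_eq]; ring
    rw [e] at this
    refine this.congr_deriv ?_
    ring
  have hid : HasDerivAt (fun y : ℝ => 2 * Complex.I * y) (2 * Complex.I) y := by
    have := (Complex.ofRealCLM.hasDerivAt (x := y)).const_mul (2 * Complex.I)
    simpa using this
  refine ((hid.mul (S.hasDerivAt_primitive g y)).sub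
    (((S.hasDerivAt_q y).mul hk).mul (hasDerivAt_exp g y))).congr_deriv ?_
  have h := S.u_mul_T22 g y
  have h1 := S.u_mul_T22 1 y
  rw [T22_eq] at h1
  simp only [Y, Y', Pi.mul_apply]
  have h2 := S.T22_eq g y
  set k := S.D y / (S.l * S.L * S.E y)
  set e := Complex.exp (2 * Complex.I * g * y)
  linear_combination (2 * k * e) * h + (2 * Complex.I * S.q y * e) * h2 - e * h1

lemma continuous_kernel (g : ℂ) :
    Continuous fun y => g * S.q y ^ 2 * S.uc y - S.T22 g y ^ 2 * S.u y := by
  have := S.continuous_q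
  have := S.continuous_uc
  have := S.continuous_u
  have := S.continuous_T22 g
  fun_prop

lemma continuous_Y (g : ℂ) : Continuous (S.Y g) := by
  have h1 := S.continuous_kernel g
  have h2 : Continuous fun y : ℝ => Complex.exp (2 * Complex.I * g * y) := by fun_prop
  exact h2.mul h1

lemma continuous_Y' (g : ℂ) : Continuous (S.Y' g) := by
  have := S.continuous_q
  have := S.continuous_uc
  have := S.continuous_u
  have := S.continuous_T22 g
  have h2 : Continuous fun y => S.D y / (S.l * S.L * S.E y) :=
    S.continuous_D.div (continuous_const.mul S.continuous_E) fun y =>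
      mul_ne_zero (mul_ne_zero S.l_ne S.L_ne) (S.E_ne y)
  unfold Y'
  fun_prop

lemma exists_norm_q_le : ∃ C, 0 ≤ C ∧ ∀ x, ‖S.q x‖ ≤ C := by
  obtain ⟨c, hc, hD⟩ := S.exists_sq_le_norm_D
  refine ⟨‖S.l ^ 2 - S.L ^ 2‖ * ‖S.n‖ / ‖S.l * S.L‖ / c, by positivity, fun x => ?_⟩
  rw [S.norm_q]
  refine div_le_div_of_nonneg_left (by positivity) hc ?_
  nlinarith [hD x, sq_nonneg x]

lemma norm_exp_of_im_eq_zero {g : ℂ} (hg : g.im = 0) (y : ℝ) :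
    ‖Complex.exp (2 * Complex.I * g * y)‖ = 1 := by
  have : 2 * Complex.I * g * y = ((2 * g.re * y : ℝ) : ℂ) * Complex.I := by
    rw [← Complex.re_add_im g, hg]
    push_cast
    simp
    ring
  rw [this, Complex.norm_exp_ofReal_mul_I]

lemma norm_uc (y : ℝ) : ‖S.uc y‖ = ‖S.u y‖ := by rw [← S.conj_u, Complex.norm_conj]

lemma integrable_Y_of_im_eq_zero {g : ℂ} (hg : g.im = 0) : Integrable (S.Y g) := by
  obtain ⟨C, hC0, hC⟩ := S.exists_norm_q_le
  refine (S.integrable_u.norm.const_mul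
    (‖g‖ * C ^ 2 + (1 + ‖g‖ / ‖S.l * S.L‖) ^ 2)).mono' (S.continuous_Y g).aestronglyMeasurable
    (ae_of_all _ fun y => ?_)
  rw [Y, norm_mul, norm_exp_of_im_eq_zero hg, one_mul, add_mul]
  refine (norm_sub_le _ _).trans (add_le_add ?_ ?_)
  · rw [norm_mul, norm_mul, norm_pow, S.norm_uc]
    have := hC y
    gcongr
  · rw [norm_mul, norm_pow]
    have := S.norm_T22_le g y
    gcongr

/-- Along `Σ` the spatial integral vanishes: the soliton is reflectionless. -/
lemma integral_Y_of_im_eq_zero {g : ℂ} (hg : g.im = 0) : ∫ y, S.Y g y = 0 := by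
  have h0 : Tendsto (fun y : ℝ => S.q y * S.T22 g y * Complex.exp (2 * Complex.I * g * y))
      (cocompact ℝ) (𝓝 0) := by
    have h1 := (tendsto_zero_iff_norm_tendsto_zero.1 S.tendsto_q_cocompact).mul_const
      (1 + ‖g‖ / ‖S.l * S.L‖)
    rw [zero_mul] at h1
    refine squeeze_zero_norm (fun y => ?_) h1
    rw [norm_mul, norm_exp_of_im_eq_zero hg, mul_one, norm_mul]
    exact mul_le_mul_of_nonneg_left (S.norm_T22_le g y) (norm_nonneg _)
  have := integral_of_hasDerivAt_of_tendsto (S.hasDerivAt_primitive g)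
    (S.integrable_Y_of_im_eq_zero hg).neg (h0.mono_left atBot_le_cocompact)
    (h0.mono_left atTop_le_cocompact)
  rw [integral_neg, sub_zero, neg_eq_zero] at this
  exact this

/-- At the eigenvalue the exponential of the second column turns `N` into a multiple of `B`. -/
lemma N_mul_exp (y : ℝ) :
    S.N y * Complex.exp (2 * Complex.I * S.l ^ 2 * y) * (starRingEnd ℂ) S.n = S.a * S.B y := by
  have h1 : Complex.exp (-Complex.I * (S.l ^ 2 + S.L ^ 2) * y)
      * Complex.exp (2 * Complex.I * S.l ^ 2 * y)
      = ((Real.exp (-(4 * S.xi * S.eta * y)) : ℝ) : ℂ) := by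
    rw [← Complex.exp_add, Complex.ofReal_exp]
    congr 1
    push_cast
    linear_combination (Complex.I * y) * S.l_sq_sub + (4 * S.xi * S.eta * y) * Complex.I_sq
  have h2 := S.n_mul_conj
  have ha : (S.a : ℂ) ≠ 0 := by exact_mod_cast S.a_pos.ne'
  rw [N, B, mul_assoc S.n, h1]
  push_cast
  field_simp
  linear_combination h2

/-- At the conjugate eigenvalue the exponential turns `N` into a multiple of `A`. -/
lemma N_mul_exp' (y : ℝ) :
    S.N y * Complex.exp (2 * Complex.I * S.L ^ 2 * y) * S.a = S.n * S.A y := by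
  have h1 : Complex.exp (-Complex.I * (S.l ^ 2 + S.L ^ 2) * y)
      * Complex.exp (2 * Complex.I * S.L ^ 2 * y)
      = ((Real.exp (4 * S.xi * S.eta * y) : ℝ) : ℂ) := by
    rw [← Complex.exp_add, Complex.ofReal_exp]
    congr 1
    push_cast
    linear_combination (-Complex.I * y) * S.l_sq_sub - (4 * S.xi * S.eta * y) * Complex.I_sq
  rw [N, A, mul_assoc S.n, h1]
  push_cast
  ring

lemma conj_n_ne : (starRingEnd ℂ) S.n ≠ 0 := by simpa using S.n_ne

/-- At the eigenvalue the part with `B` cancels, so that the second column becomes a bound state. -/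
lemma T22_l (y : ℝ) : S.T22 (S.l ^ 2) y = -((S.l ^ 2 - S.L ^ 2) * S.A y / (S.L * S.E y)) := by
  have hE := S.E_ne y
  have hl := S.l_ne
  have hL := S.L_ne
  rw [T22]
  field_simp
  simp only [D, E]
  ring

lemma T11_l (y : ℝ) : S.T11 (S.l ^ 2) y = -((S.l ^ 2 - S.L ^ 2) * S.B y / (S.L * S.D y)) := by
  have hD := S.D_ne y
  have hl := S.l_ne
  have hL := S.L_ne
  rw [T11]
  field_simp
  simp only [D, E]
  ring

/-- At the eigenvalue the primitive of `Y` is a multiple of `|q|²`, so that it vanishes at both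
ends. -/
lemma primitive_l (y : ℝ) :
    S.q y * S.T22 (S.l ^ 2) y * Complex.exp (2 * Complex.I * S.l ^ 2 * y)
      = S.a * S.l / (starRingEnd ℂ) S.n * (S.q y * S.qc y) := by
  have hE := S.E_ne y
  have hD := S.D_ne y
  have hl := S.l_ne
  have hL := S.L_ne
  have hn := S.conj_n_ne
  have h := S.N_mul_exp y
  have h2 := S.N_mul_M y
  rw [T22_l, q, qc]
  generalize Complex.exp (2 * Complex.I * S.l ^ 2 * y) = e at h ⊢
  field_simp
  linear_combination (-(S.l ^ 2 - S.L ^ 2) ^ 2 * S.A y) * h + ((S.l ^ 2 - S.L ^ 2) ^ 2 * S.a) * h2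

/-- The part of the `g`-derivative of the primitive that has a nonzero limit at `-∞`. -/
lemma primitive_l' (y : ℝ) :
    S.q y * (S.D y / (S.l * S.L * S.E y)) * Complex.exp (2 * Complex.I * S.l ^ 2 * y)
      = (S.l ^ 2 - S.L ^ 2) * S.a / ((starRingEnd ℂ) S.n * S.l ^ 2 * S.L ^ 2)
        * (S.B y / S.E y) := by
  have hE := S.E_ne y
  have hD := S.D_ne y
  have hl := S.l_ne
  have hL := S.L_ne
  have hn := S.conj_n_ne
  have h := S.N_mul_exp y
  rw [q]
  generalize Complex.exp (2 * Complex.I * S.l ^ 2 * y) = e at h ⊢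
  field_simp
  linear_combination (S.l ^ 2 - S.L ^ 2) * h

lemma Y_l (y : ℝ) :
    S.Y (S.l ^ 2) y
      = -(S.a * S.l / (starRingEnd ℂ) S.n * (S.u y * S.qc y + S.q y * S.uc y)) := by
  have h1 := S.hasDerivAt_primitive (S.l ^ 2) y
  rw [funext S.primitive_l] at h1
  have h2 := ((S.hasDerivAt_q y).mul (S.hasDerivAt_qc y)).const_mul
    (S.a * S.l / (starRingEnd ℂ) S.n)
  rw [← h1.unique h2, neg_neg]

/-- The `g`-derivative of `Y` at the eigenvalue as a sum of terms whose decay is evident. -/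
lemma Y'_l (y : ℝ) :
    S.Y' (S.l ^ 2) y = 2 * Complex.I * y * S.Y (S.l ^ 2) y
      - 2 * Complex.I * (S.a * S.l / (starRingEnd ℂ) S.n * (S.q y * S.qc y))
      + (S.l ^ 2 - S.L ^ 2) * S.a / ((starRingEnd ℂ) S.n * S.l ^ 2 * S.L ^ 2)
        * (2 * Complex.I * (S.l ^ 2 - S.L ^ 2) * S.L * (‖S.n‖ : ℂ) ^ 2 / S.E y ^ 2) := by
  have hE := S.E_ne y
  have hid : HasDerivAt (fun y : ℝ => 2 * Complex.I * y) (2 * Complex.I) y := by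
    have := (Complex.ofRealCLM.hasDerivAt (x := y)).const_mul (2 * Complex.I)
    simpa using this
  have h1 := S.hasDerivAt_primitive' (S.l ^ 2) y
  simp only [S.primitive_l'] at h1
  have h3 := ((S.hasDerivAt_B y).div (S.hasDerivAt_E y) hE).const_mul
    ((S.l ^ 2 - S.L ^ 2) * S.a / ((starRingEnd ℂ) S.n * S.l ^ 2 * S.L ^ 2))
  have h2 := (hid.mul (S.hasDerivAt_primitive (S.l ^ 2) y)).sub h3
  have h4 := h1.unique h2
  rw [S.primitive_l] at h4
  have h5 : (Complex.I * (S.l ^ 2 - S.L ^ 2) * S.B y * S.E y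
      - S.B y * (-Complex.I * (S.l ^ 2 - S.L ^ 2) * (S.L * S.A y - S.l * S.B y))) / S.E y ^ 2
      = 2 * Complex.I * (S.l ^ 2 - S.L ^ 2) * S.L * (‖S.n‖ : ℂ) ^ 2 / S.E y ^ 2 := by
    congr 1
    have : (S.A y : ℂ) * S.B y = (‖S.n‖ : ℂ) ^ 2 := by exact_mod_cast S.A_mul_B y
    rw [← this]
    simp only [E]
    ring
  rw [h5] at h4
  linear_combination -h4

lemma norm_qc (y : ℝ) : ‖S.qc y‖ = ‖S.q y‖ := by rw [← S.conj_q, Complex.norm_conj]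

lemma exists_norm_Y_l_le : ∃ C, 0 ≤ C ∧ ∀ y, ‖S.Y (S.l ^ 2) y‖ ≤ C / ‖S.D y‖ ^ 2 := by
  refine ⟨‖S.a * S.l / (starRingEnd ℂ) S.n‖ *
    (2 * (2 * ‖S.l ^ 2 - S.L ^ 2‖ * ‖S.n‖) * (‖S.l ^ 2 - S.L ^ 2‖ * ‖S.n‖ / ‖S.l * S.L‖)),
    by positivity, fun y => ?_⟩
  rw [S.Y_l, norm_neg, norm_mul, mul_div_assoc ‖S.a * S.l / (starRingEnd ℂ) S.n‖]
  refine mul_le_mul_of_nonneg_left ?_ (norm_nonneg _)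
  refine (norm_add_le _ _).trans (le_of_eq ?_)
  rw [norm_mul, norm_mul, S.norm_qc, S.norm_uc, S.norm_q, S.norm_u]
  have := (S.norm_D_pos y).ne'
  field_simp
  ring

lemma integrable_Y_l : Integrable (S.Y (S.l ^ 2)) := by
  obtain ⟨C, hC0, hC⟩ := S.exists_norm_Y_l_le
  refine S.integrable_of_norm_le_mul (S.continuous_Y _).aestronglyMeasurable (C := C)
    fun y => (hC y).trans ?_
  have := S.norm_D_pos y
  gcongr
  nlinarith [abs_nonneg y]

lemma integrable_Y'_l : Integrable (S.Y' (S.l ^ 2)) := by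
  obtain ⟨C, hC0, hC⟩ := S.exists_norm_Y_l_le
  set c1 := S.a * S.l / (starRingEnd ℂ) S.n with hc1
  set c2 := (S.l ^ 2 - S.L ^ 2) * S.a / ((starRingEnd ℂ) S.n * S.l ^ 2 * S.L ^ 2) with hc2
  set c3 := 2 * Complex.I * (S.l ^ 2 - S.L ^ 2) * S.L * (‖S.n‖ : ℂ) ^ 2 with hc3
  set c4 := ‖S.l ^ 2 - S.L ^ 2‖ * ‖S.n‖ / ‖S.l * S.L‖ with hc4
  refine S.integrable_of_norm_le_mul (S.continuous_Y' _).aestronglyMeasurable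
    (C := 2 * C + 2 * (‖c1‖ * (c4 * c4)) + ‖c2‖ * ‖c3‖) fun y => ?_
  have hD := S.norm_D_pos y
  have hy := abs_nonneg y
  rw [S.Y'_l, ← hc1, ← hc2, ← hc3, add_mul, add_mul, add_div, add_div]
  refine (norm_add_le _ _).trans (add_le_add ((norm_sub_le _ _).trans (add_le_add ?_ ?_)) ?_)
  · rw [norm_mul, norm_mul, norm_mul, Complex.norm_I, Complex.norm_ofNat, Complex.norm_real,
      Real.norm_eq_abs, mul_one]
    calc 2 * |y| * ‖S.Y (S.l ^ 2) y‖ ≤ 2 * |y| * (C / ‖S.D y‖ ^ 2) :=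
          mul_le_mul_of_nonneg_left (hC y) (by positivity)
      _ = 2 * C * |y| / ‖S.D y‖ ^ 2 := by ring
      _ ≤ _ := by gcongr; linarith
  · rw [norm_mul, norm_mul, norm_mul, norm_mul, Complex.norm_I, Complex.norm_ofNat, S.norm_qc,
      S.norm_q, ← hc4, mul_one]
    calc 2 * (‖c1‖ * (c4 / ‖S.D y‖ * (c4 / ‖S.D y‖)))
        = 2 * (‖c1‖ * (c4 * c4)) * 1 / ‖S.D y‖ ^ 2 := by field_simp
      _ ≤ _ := by gcongr; linarith
  · rw [norm_mul, norm_div c3, norm_pow, S.norm_E]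
    calc ‖c2‖ * (‖c3‖ / ‖S.D y‖ ^ 2) = ‖c2‖ * ‖c3‖ * 1 / ‖S.D y‖ ^ 2 := by ring
      _ ≤ _ := by gcongr; linarith

lemma tendsto_q_mul_qc : Tendsto (fun y => S.q y * S.qc y) (cocompact ℝ) (𝓝 0) := by
  have h := (tendsto_zero_iff_norm_tendsto_zero.1 S.tendsto_q_cocompact)
  have h2 := h.mul h
  rw [mul_zero] at h2
  refine squeeze_zero_norm (fun y => ?_) h2
  rw [norm_mul, S.norm_qc]

lemma tendsto_mul_q_mul_qc :
    Tendsto (fun y : ℝ => 2 * Complex.I * y * (S.a * S.l / (starRingEnd ℂ) S.n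
      * (S.q y * S.qc y))) (cocompact ℝ) (𝓝 0) := by
  have h := (tendsto_zero_iff_norm_tendsto_zero.1 S.tendsto_q_cocompact)
  have h2 := ((S.isDecaying.rapid 1).mul h).const_mul (2 * ‖S.a * S.l / (starRingEnd ℂ) S.n‖)
  rw [mul_zero, mul_zero] at h2
  refine squeeze_zero_norm (fun y => le_of_eq ?_) h2
  rw [norm_mul, norm_mul, norm_mul, norm_mul, norm_mul, Complex.norm_I, Complex.norm_ofNat,
    Complex.norm_real, Real.norm_eq_abs, S.norm_qc]
  ring

lemma integral_Y_l : ∫ y, S.Y (S.l ^ 2) y = 0 := by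
  have h0 : Tendsto (fun y : ℝ => S.q y * S.T22 (S.l ^ 2) y
      * Complex.exp (2 * Complex.I * S.l ^ 2 * y)) (cocompact ℝ) (𝓝 0) := by
    have := S.tendsto_q_mul_qc.const_mul (S.a * S.l / (starRingEnd ℂ) S.n)
    rw [mul_zero] at this
    exact this.congr fun y => (S.primitive_l y).symm
  have := integral_of_hasDerivAt_of_tendsto (S.hasDerivAt_primitive (S.l ^ 2))
    S.integrable_Y_l.neg (h0.mono_left atBot_le_cocompact) (h0.mono_left atTop_le_cocompact)
  rw [integral_neg, sub_zero, neg_eq_zero] at this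
  exact this

/-- The only boundary term that survives comes from `-∞`, where the derivative of the second
column with respect to the spectral parameter grows as fast as the bound state decays. -/
lemma integral_Y'_l :
    ∫ y, S.Y' (S.l ^ 2) y
      = -((S.l ^ 2 - S.L ^ 2) * S.a / ((starRingEnd ℂ) S.n * S.l ^ 3 * S.L ^ 2)) := by
  have hl := S.l_ne
  have hL := S.L_ne
  have hn := S.conj_n_ne
  set c := (S.l ^ 2 - S.L ^ 2) * S.a / ((starRingEnd ℂ) S.n * S.l ^ 2 * S.L ^ 2) with hc
  have e : (fun y : ℝ => 2 * Complex.I * y * (S.q y * S.T22 (S.l ^ 2) y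
        * Complex.exp (2 * Complex.I * S.l ^ 2 * y))
      - S.q y * (S.D y / (S.l * S.L * S.E y)) * Complex.exp (2 * Complex.I * S.l ^ 2 * y))
      = fun y : ℝ => 2 * Complex.I * y * (S.a * S.l / (starRingEnd ℂ) S.n * (S.q y * S.qc y))
        - c * ((0 * S.A y + 1 * S.B y) / (S.L * S.A y + S.l * S.B y)) := by
    funext y
    rw [S.primitive_l, S.primitive_l', E, zero_mul, zero_add, one_mul]
  have hbot := (S.tendsto_mul_q_mul_qc.mono_left atBot_le_cocompact).sub
    ((S.tendsto_ratio_atBot 0 1 S.L S.l hl).const_mul c)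
  have htop := (S.tendsto_mul_q_mul_qc.mono_left atTop_le_cocompact).sub
    ((S.tendsto_ratio_atTop 0 1 S.L S.l hL).const_mul c)
  rw [← e] at hbot htop
  have := integral_of_hasDerivAt_of_tendsto (S.hasDerivAt_primitive' (S.l ^ 2))
    S.integrable_Y'_l.neg hbot htop
  rw [integral_neg] at this
  rw [← neg_inj, this, hc]
  field_simp
  ring

/-- The quadratic expression `φ₁² u^* - φ₂² u` for the first column of the dressed wave matrix,
which is tied to `Y` by the conjugation symmetry of the Lax equation. -/
def Yc (g : ℂ) (y : ℝ) : ℂ :=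
  Complex.exp (-(2 * Complex.I * g * y)) * (S.T11 g y ^ 2 * S.uc y - g * S.qc y ^ 2 * S.u y)

lemma conj_E (x : ℝ) : (starRingEnd ℂ) (S.E x) = S.D x := by
  rw [← S.conj_D, Complex.conj_conj]

lemma conj_T22 (g : ℂ) (x : ℝ) : (starRingEnd ℂ) (S.T22 g x) = S.T11 ((starRingEnd ℂ) g) x := by
  simp only [T22, T11, map_sub, map_one, map_div₀, map_mul, S.conj_D, S.conj_E, S.conj_l, S.conj_L]
  rw [mul_comm S.L S.l]

lemma Yc_eq (g : ℂ) (y : ℝ) : S.Yc g y = -(starRingEnd ℂ) (S.Y ((starRingEnd ℂ) g) y) := by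
  have h : (starRingEnd ℂ) (S.uc y) = S.u y := by rw [← S.conj_u, Complex.conj_conj]
  simp only [Y, Yc, map_sub, map_mul, map_pow, ← Complex.exp_conj, S.conj_T22, S.conj_q, S.conj_u,
    h, Complex.conj_conj, Complex.conj_I, Complex.conj_ofReal, map_ofNat]
  have : 2 * -Complex.I * g * y = -(2 * Complex.I * g * y) := by ring
  rw [this]
  ring

lemma hasDerivAt_Yc (g : ℂ) (y : ℝ) :
    HasDerivAt (fun g => S.Yc g y) (-(starRingEnd ℂ) (S.Y' ((starRingEnd ℂ) g) y)) g := by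
  simp only [Yc_eq]
  have := (S.hasDerivAt_Y ((starRingEnd ℂ) g) y).conj_conj
  rw [Complex.conj_conj] at this
  exact this.neg

lemma integrable_neg_conj {f : ℝ → ℂ} (hf : Integrable f) :
    Integrable fun y => -(starRingEnd ℂ) (f y) :=
  (Complex.conjLIE.integrable_comp_iff.2 hf).neg

lemma integral_neg_conj (f : ℝ → ℂ) :
    ∫ y, -(starRingEnd ℂ) (f y) = -(starRingEnd ℂ) (∫ y, f y) := by
  rw [integral_neg, integral_conj]

lemma conj_L_sq : (starRingEnd ℂ) (S.L ^ 2) = S.l ^ 2 := by rw [map_pow, S.conj_L]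

lemma integrable_Yc_of_im_eq_zero {g : ℂ} (hg : g.im = 0) : Integrable (S.Yc g) := by
  rw [funext (S.Yc_eq g)]
  exact integrable_neg_conj (S.integrable_Y_of_im_eq_zero (by simpa using hg))

lemma integral_Yc_of_im_eq_zero {g : ℂ} (hg : g.im = 0) : ∫ y, S.Yc g y = 0 := by
  rw [funext (S.Yc_eq g), integral_neg_conj, S.integral_Y_of_im_eq_zero (by simpa using hg)]
  simp

lemma integrable_Yc_L : Integrable (S.Yc (S.L ^ 2)) := by
  rw [funext (S.Yc_eq _), S.conj_L_sq]
  exact integrable_neg_conj S.integrable_Y_l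

lemma integral_Yc_L : ∫ y, S.Yc (S.L ^ 2) y = 0 := by
  rw [funext (S.Yc_eq _), S.conj_L_sq, integral_neg_conj, S.integral_Y_l]
  simp

/-! ### The kernels and the contour integrals -/

/-- The `x`-derivative of the squared upper entry of the first dressed column. -/
def X1 (x : ℝ) (g : ℂ) : ℂ :=
  Complex.exp (-(2 * Complex.I * g * x))
    * (-2 * g * S.u x * S.qc x * S.T11 g x - 2 * Complex.I * g * S.T11 g x ^ 2)

/-- The `x`-derivative of the squared upper entry of the second dressed column. -/
def X2 (x : ℝ) (g : ℂ) : ℂ :=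
  g * Complex.exp (2 * Complex.I * g * x)
    * (2 * S.q x * S.u x + 2 * Complex.I * g * S.q x ^ 2)

lemma deriv_m1_sq (z : ℂ) (x : ℝ) :
    deriv (fun x' : ℝ => (S.jost.m1 z x' 0) ^ 2) x
      = ((1 - z ^ 2 / S.L ^ 2)⁻¹) ^ 2 * S.X1 x (z ^ 2) := by
  have h : HasDerivAt (fun x' : ℝ => (S.jost.m1 z x' 0) ^ 2) _ x :=
    (((S.hasDerivAt_T11 (z ^ 2) x).mul
      (hasDerivAt_cexp (-Complex.I * z ^ 2) x)).const_mul ((1 - z ^ 2 / S.L ^ 2)⁻¹)).pow 2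
  rw [h.deriv, X1]
  have e : Complex.exp (-(2 * Complex.I * z ^ 2 * x))
      = Complex.exp (-Complex.I * z ^ 2 * x) ^ 2 := by
    rw [← Complex.exp_nat_mul]; congr 1; push_cast; ring
  rw [e]
  simp only [Pi.mul_apply]
  push_cast
  ring

lemma deriv_m2_sq (z : ℂ) (x : ℝ) :
    deriv (fun x' : ℝ => (S.jost.m2 z x' 0) ^ 2) x
      = ((1 - z ^ 2 / S.l ^ 2)⁻¹) ^ 2 * S.X2 x (z ^ 2) := by
  have h : HasDerivAt (fun x' : ℝ => (S.jost.m2 z x' 0) ^ 2) _ x :=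
    ((((S.hasDerivAt_q x).const_mul z).mul
      (hasDerivAt_cexp (Complex.I * z ^ 2) x)).const_mul ((1 - z ^ 2 / S.l ^ 2)⁻¹)).pow 2
  rw [h.deriv, X2]
  have e : Complex.exp (2 * Complex.I * z ^ 2 * x)
      = Complex.exp (Complex.I * z ^ 2 * x) ^ 2 := by
    rw [← Complex.exp_nat_mul]; congr 1; push_cast; ring
  rw [e]
  simp only [Pi.mul_apply]
  push_cast
  ring

lemma p2_sq (z : ℂ) (y : ℝ) :
    (S.jost.p2 z y 0) ^ 2 * (starRingEnd ℂ) (S.u y) - (S.jost.p2 z y 1) ^ 2 * S.u y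
      = ((1 - z ^ 2 / S.L ^ 2)⁻¹) ^ 2 * S.Y (z ^ 2) y := by
  have e : Complex.exp (2 * Complex.I * z ^ 2 * y)
      = Complex.exp (Complex.I * z ^ 2 * y) ^ 2 := by
    rw [← Complex.exp_nat_mul]; congr 1; push_cast; ring
  simp only [jost, col2, Y, e, S.conj_u, Pi.smul_apply, smul_eq_mul, Matrix.cons_val_zero,
    Matrix.cons_val_one, Matrix.cons_val_fin_one]
  ring

lemma p1_sq (z : ℂ) (y : ℝ) :
    (S.jost.p1 z y 0) ^ 2 * (starRingEnd ℂ) (S.u y) - (S.jost.p1 z y 1) ^ 2 * S.u y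
      = ((1 - z ^ 2 / S.l ^ 2)⁻¹) ^ 2 * S.Yc (z ^ 2) y := by
  have e : Complex.exp (-(2 * Complex.I * z ^ 2 * y))
      = Complex.exp (-Complex.I * z ^ 2 * y) ^ 2 := by
    rw [← Complex.exp_nat_mul]; congr 1; push_cast; ring
  simp only [jost, col1, Yc, e, S.conj_u, Pi.smul_apply, smul_eq_mul, Matrix.cons_val_zero,
    Matrix.cons_val_one, Matrix.cons_val_fin_one]
  ring

lemma kernelPlus_eq (eps : ℝ) (x : ℝ) {z : ℂ} (hz : 0 ≤ (z ^ 2).im) (y : ℝ) :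
    kernelPlus eps S.u S.jost S.s11 x z y
      = weight eps z / (z ^ 3 * (1 - z ^ 2 / S.l ^ 2) ^ 2)
        * (((1 - z ^ 2 / S.L ^ 2)⁻¹) ^ 2 * S.X1 x (z ^ 2)) * S.Y (z ^ 2) y := by
  have h := S.one_sub_div_L_ne hz
  rw [kernelPlus, S.deriv_m1_sq, S.p2_sq, s11, ← weight]
  generalize 1 - z ^ 2 / S.L ^ 2 = k at h ⊢
  generalize 1 - z ^ 2 / S.l ^ 2 = m
  have : weight eps z / (z ^ 3 * (m * k⁻¹) ^ 2) = weight eps z / (z ^ 3 * m ^ 2) * k ^ 2 := by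
    rw [mul_pow, inv_pow, ← mul_assoc, ← div_eq_mul_inv, div_div_eq_mul_div, mul_div_right_comm]
  rw [this]
  have hk : k⁻¹ ^ 2 * k ^ 2 = 1 := by rw [← mul_pow, inv_mul_cancel₀ h, one_pow]
  linear_combination (weight eps z / (z ^ 3 * m ^ 2) * (k⁻¹ ^ 2 * S.X1 x (z ^ 2))
    * S.Y (z ^ 2) y) * hk

lemma kernelMinus_eq (eps : ℝ) (x : ℝ) {z : ℂ} (hz : (z ^ 2).im ≤ 0) (y : ℝ) :
    kernelMinus eps S.u S.jost S.s22 x z y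
      = weight eps z / (z ^ 3 * (1 - z ^ 2 / S.L ^ 2) ^ 2)
        * (((1 - z ^ 2 / S.l ^ 2)⁻¹) ^ 2 * S.X2 x (z ^ 2)) * S.Yc (z ^ 2) y := by
  have h := S.one_sub_div_l_ne hz
  rw [kernelMinus, S.deriv_m2_sq, S.p1_sq, s22, ← weight]
  generalize 1 - z ^ 2 / S.l ^ 2 = k at h ⊢
  generalize 1 - z ^ 2 / S.L ^ 2 = m
  have : weight eps z / (z ^ 3 * (m * k⁻¹) ^ 2) = weight eps z / (z ^ 3 * m ^ 2) * k ^ 2 := by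
    rw [mul_pow, inv_pow, ← mul_assoc, ← div_eq_mul_inv, div_div_eq_mul_div, mul_div_right_comm]
  rw [this]
  have hk : k⁻¹ ^ 2 * k ^ 2 = 1 := by rw [← mul_pow, inv_mul_cancel₀ h, one_pow]
  linear_combination (weight eps z / (z ^ 3 * m ^ 2) * (k⁻¹ ^ 2 * S.X2 x (z ^ 2))
    * S.Yc (z ^ 2) y) * hk

lemma differentiable_X1 (x : ℝ) : Differentiable ℂ (S.X1 x) := by
  unfold X1
  simp only [T11_eq]
  fun_prop

lemma differentiable_X2 (x : ℝ) : Differentiable ℂ (S.X2 x) := by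
  unfold X2
  fun_prop

lemma X1_l (x : ℝ) :
    S.X1 x (S.l ^ 2) = (starRingEnd ℂ) S.n / S.a * (2 * Complex.I * S.l
      * (S.l ^ 2 - S.L ^ 2) ^ 2 * S.B x * S.N x / (S.L ^ 2 * S.D x ^ 3)
      * ((S.l ^ 2 - 2 * S.L ^ 2) * S.A x - S.l * S.L * S.B x)) := by
  have hE := S.E_ne x
  have hD := S.D_ne x
  have hl := S.l_ne
  have hL := S.L_ne
  have ha : (S.a : ℂ) ≠ 0 := by exact_mod_cast S.a_pos.ne'
  have h2 := S.N_mul_M x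
  have h : Complex.exp (-(2 * Complex.I * S.l ^ 2 * x)) * S.B x
      = (starRingEnd ℂ) S.n / S.a * S.N x := by
    have h3 := S.N_mul_exp x
    rw [Complex.exp_neg]
    have h4 := Complex.exp_ne_zero (2 * Complex.I * S.l ^ 2 * x)
    generalize Complex.exp (2 * Complex.I * S.l ^ 2 * x) = e at h3 h4 ⊢
    field_simp
    linear_combination -h3
  have h5 : S.X1 x (S.l ^ 2) = Complex.exp (-(2 * Complex.I * S.l ^ 2 * x)) * S.B x
      * (2 * Complex.I * S.l * (S.l ^ 2 - S.L ^ 2) ^ 2 * S.B x / (S.L ^ 2 * S.D x ^ 3)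
      * ((S.l ^ 2 - 2 * S.L ^ 2) * S.A x - S.l * S.L * S.B x)) := by
    have h6 : S.u x * S.qc x = 2 * Complex.I * (S.l ^ 2 - S.L ^ 2) ^ 2 * (S.A x * S.B x)
        / (S.l * S.L * S.D x ^ 2) := by
      rw [u, qc, ← h2]
      field_simp
    rw [X1, mul_assoc (-2 * S.l ^ 2), h6, T11_l, mul_assoc (Complex.exp _)]
    congr 1
    field_simp
    simp only [D]
    ring
  rw [h5, h]
  ring

lemma X2_L (x : ℝ) :
    S.X2 x (S.L ^ 2) = S.n / S.a * (2 * Complex.I * S.L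
      * (S.l ^ 2 - S.L ^ 2) ^ 2 * S.A x * S.N x / (S.l ^ 2 * S.D x ^ 3)
      * ((S.L ^ 2 - 2 * S.l ^ 2) * S.B x - S.l * S.L * S.A x)) := by
  have hD := S.D_ne x
  have hl := S.l_ne
  have hL := S.L_ne
  have ha : (S.a : ℂ) ≠ 0 := by exact_mod_cast S.a_pos.ne'
  have h : S.N x * Complex.exp (2 * Complex.I * S.L ^ 2 * x) = S.n / S.a * S.A x := by
    have h3 := S.N_mul_exp' x
    field_simp
    linear_combination h3
  have h5 : S.X2 x (S.L ^ 2) = S.N x * Complex.exp (2 * Complex.I * S.L ^ 2 * x)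
      * (2 * Complex.I * S.L
      * (S.l ^ 2 - S.L ^ 2) ^ 2 * S.N x / (S.l ^ 2 * S.D x ^ 3)
      * ((S.L ^ 2 - 2 * S.l ^ 2) * S.B x - S.l * S.L * S.A x)) := by
    rw [X2, q, u]
    generalize Complex.exp (2 * Complex.I * S.L ^ 2 * x) = e
    field_simp
    simp only [D, E]
    ring
  rw [h5, h]
  ring

lemma hasGammaIntegral_kernelPlus (eps x : ℝ) :
    HasGammaIntegral 1 {S.l, -S.l} (kernelPlus eps S.u S.jost S.s11 x)
      (4 * Real.pi * weight eps S.l * (S.l ^ 2 - S.L ^ 2) * S.B x * S.N x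
        / (S.l ^ 2 * S.D x ^ 3) * ((S.l ^ 2 - 2 * S.L ^ 2) * S.A x - S.l * S.L * S.B x)) := by
  have hl := S.l_ne
  have hL := S.L_ne
  have hn := S.conj_n_ne
  have hD := S.D_ne x
  have hd := S.l_sq_sub_ne
  have ha : (S.a : ℂ) ≠ 0 := by exact_mod_cast S.a_pos.ne'
  have hev : ∀ᶠ g in 𝓝 (S.l ^ 2), 0 < g.im :=
    Complex.continuous_im.continuousAt.eventually (lt_mem_nhds S.l_sq_im_pos)
  have key := hasGammaIntegral_of_reflectionless (eps := eps) (orient := 1) (b := S.l)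
    (P := fun g => ((1 - g / S.L ^ 2)⁻¹) ^ 2 * S.X1 x g) (Y := S.Y) (Y1 := S.Y' (S.l ^ 2))
    (K := kernelPlus eps S.u S.jost S.s11 x) S.l_ne ?_
    (fun y g => (S.hasDerivAt_Y g y).differentiableAt) (S.hasDerivAt_Y (S.l ^ 2)) ?_
    S.integrable_Y_l S.integral_Y_l S.integrable_Y'_l S.integral_Y'_l ?_
  · convert key using 1
    have h1 : 1 - S.l ^ 2 / S.L ^ 2 = -((S.l ^ 2 - S.L ^ 2) / S.L ^ 2) := by field_simp; ring
    simp only [h1, S.X1_l]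
    field_simp
    linear_combination (weight eps S.l * S.B x * S.N x * (4 * (S.l ^ 2 - 2 * S.L ^ 2) * S.A x
      - 4 * S.l * S.L * S.B x)) * Complex.I_sq
  · filter_upwards [hev] with g hg
    have h0 := S.one_sub_div_L_ne hg.le
    have h1 : DifferentiableAt ℂ (fun g => (1 - g / S.L ^ 2)⁻¹) g :=
      DifferentiableAt.inv (by fun_prop) h0
    exact (h1.pow 2).mul (S.differentiable_X1 x g)
  · filter_upwards [hev] with g hg z hz y
    exact S.kernelPlus_eq eps x (by rw [hz]; exact hg.le) y
  · intro z hz hzi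
    rw [funext (S.kernelPlus_eq eps x hzi.ge)]
    refine ⟨(S.integrable_Y_of_im_eq_zero hzi).const_mul _, ?_⟩
    rw [integral_const_mul, S.integral_Y_of_im_eq_zero hzi, mul_zero]

lemma integrable_Yc'_L : Integrable fun y => -(starRingEnd ℂ) (S.Y' (S.l ^ 2) y) :=
  integrable_neg_conj S.integrable_Y'_l

lemma integral_Yc'_L : ∫ y, -(starRingEnd ℂ) (S.Y' (S.l ^ 2) y)
    = -((S.l ^ 2 - S.L ^ 2) * S.a / (S.n * S.L ^ 3 * S.l ^ 2)) := by
  rw [integral_neg_conj, S.integral_Y'_l]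
  simp only [map_neg, map_div₀, map_mul, map_sub, map_pow, S.conj_l, S.conj_L, Complex.conj_conj,
    Complex.conj_ofReal]
  ring

lemma weight_L (eps : ℝ) : weight eps S.L = weight eps S.l := by
  rw [weight, weight, norm_mul, norm_mul, norm_pow, norm_pow, S.norm_L]

lemma hasGammaIntegral_kernelMinus (eps x : ℝ) :
    HasGammaIntegral (-1) {S.L, -S.L} (kernelMinus eps S.u S.jost S.s22 x)
      (-(4 * Real.pi * weight eps S.l * (S.l ^ 2 - S.L ^ 2) * S.A x * S.N x
        / (S.L ^ 2 * S.D x ^ 3) * ((S.L ^ 2 - 2 * S.l ^ 2) * S.B x - S.l * S.L * S.A x))) := by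
  have hl := S.l_ne
  have hL := S.L_ne
  have hn := S.n_ne
  have hD := S.D_ne x
  have hd := S.l_sq_sub_ne
  have ha : (S.a : ℂ) ≠ 0 := by exact_mod_cast S.a_pos.ne'
  have hev : ∀ᶠ g in 𝓝 (S.L ^ 2), g.im < 0 :=
    Complex.continuous_im.continuousAt.eventually (gt_mem_nhds S.L_sq_im_neg)
  have hder (y : ℝ) : HasDerivAt (fun g => S.Yc g y)
      (-(starRingEnd ℂ) (S.Y' (S.l ^ 2) y)) (S.L ^ 2) := by
    have := S.hasDerivAt_Yc (S.L ^ 2) y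
    rwa [S.conj_L_sq] at this
  have key := hasGammaIntegral_of_reflectionless (eps := eps) (orient := -1) (b := S.L)
    (P := fun g => ((1 - g / S.l ^ 2)⁻¹) ^ 2 * S.X2 x g) (Y := S.Yc)
    (Y1 := fun y => -(starRingEnd ℂ) (S.Y' (S.l ^ 2) y))
    (K := kernelMinus eps S.u S.jost S.s22 x) S.L_ne ?_
    (fun y g => (S.hasDerivAt_Yc g y).differentiableAt) hder ?_
    S.integrable_Yc_L S.integral_Yc_L S.integrable_Yc'_L S.integral_Yc'_L ?_
  · convert key using 1
    have h1 : 1 - S.L ^ 2 / S.l ^ 2 = (S.l ^ 2 - S.L ^ 2) / S.l ^ 2 := by field_simp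
    simp only [h1, S.X2_L, S.weight_L]
    field_simp
    linear_combination (-(weight eps S.l * S.A x * S.N x * (4 * (S.L ^ 2 - 2 * S.l ^ 2) * S.B x
      - 4 * S.l * S.L * S.A x))) * Complex.I_sq
  · filter_upwards [hev] with g hg
    have h0 := S.one_sub_div_l_ne hg.le
    have h1 : DifferentiableAt ℂ (fun g => (1 - g / S.l ^ 2)⁻¹) g :=
      DifferentiableAt.inv (by fun_prop) h0
    exact (h1.pow 2).mul (S.differentiable_X2 x g)
  · filter_upwards [hev] with g hg z hz y
    exact S.kernelMinus_eq eps x (by rw [hz]; exact hg.le) y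
  · intro z hz hzi
    rw [funext (S.kernelMinus_eq eps x hzi.le)]
    refine ⟨(S.integrable_Yc_of_im_eq_zero hzi).const_mul _, ?_⟩
    rw [integral_const_mul, S.integral_Yc_of_im_eq_zero hzi, mul_zero]

end Soliton

/-! ### Evolution in time -/

/-- The soliton at the time `t`, with `c = nu21 / nu11`. -/
def Soliton.atTime {xi eta : ℝ} (eps : ℝ) {c : ℂ} (hxi : 0 < xi) (heta : 0 < eta) (hc : c ≠ 0)
    (t : ℝ) : Soliton where
  xi := xi
  eta := eta
  a := Real.exp (2 * thetaR xi eta eps 0 t)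
  n := (starRingEnd ℂ) c * Complex.exp (2 * Complex.I * thetaI xi eta eps 0 t)
  xi_pos := hxi
  eta_pos := heta
  a_pos := Real.exp_pos _
  n_ne := mul_ne_zero (by simpa using hc) (Complex.exp_ne_zero _)

section Evolution

variable {xi eta eps : ℝ} {c : ℂ} (hxi : 0 < xi) (heta : 0 < eta) (hc : c ≠ 0)

open Soliton

lemma atTime_A (x t : ℝ) :
    (atTime eps hxi heta hc t).A x = Real.exp (2 * thetaR xi eta eps x t) := by
  simp only [A, atTime]
  rw [← Real.exp_add]
  congr 1
  simp only [thetaR]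
  ring

lemma norm_atTime_n (t : ℝ) : ‖(atTime eps hxi heta hc t).n‖ = ‖c‖ := by
  have : 2 * Complex.I * (thetaI xi eta eps 0 t : ℂ)
      = ((2 * thetaI xi eta eps 0 t : ℝ) : ℂ) * Complex.I := by push_cast; ring
  simp only [atTime]
  rw [norm_mul, this, Complex.norm_exp_ofReal_mul_I, mul_one, Complex.norm_conj]

lemma atTime_B (x t : ℝ) :
    (atTime eps hxi heta hc t).B x = ‖c‖ ^ 2 * Real.exp (-(2 * thetaR xi eta eps x t)) := by
  rw [B, norm_atTime_n]
  simp only [atTime]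
  rw [div_eq_mul_inv, ← Real.exp_neg, mul_assoc, ← Real.exp_add]
  congr 2
  simp only [thetaR]
  ring

lemma atTime_N (x t : ℝ) :
    (atTime eps hxi heta hc t).N x
      = (starRingEnd ℂ) c * Complex.exp (2 * Complex.I * thetaI xi eta eps x t) := by
  rw [N, l_sq_add]
  simp only [atTime]
  rw [mul_assoc, ← Complex.exp_add]
  congr 2
  simp only [thetaI]
  push_cast
  ring

/-- The one-soliton is the potential of the dressing matrix. -/
lemma oneSoliton_eq {nu11 nu21 : ℂ} (hnu11 : nu11 ≠ 0) (hnu21 : nu21 ≠ 0) (x t : ℝ) :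
    oneSoliton xi eta eps nu11 nu21 x t
      = (atTime eps hxi heta (div_ne_zero hnu21 hnu11) t).q x := by
  set S := atTime eps hxi heta (div_ne_zero hnu21 hnu11) t with hS
  have hl : S.l = xi + Complex.I * eta := rfl
  have hL : S.L = xi - Complex.I * eta := rfl
  have hl0 := S.l_ne
  have hL0 := S.L_ne
  have hD0 := S.D_ne x
  have hr : 0 < xi ^ 2 + eta ^ 2 := by positivity
  have hs : ((Real.sqrt (xi ^ 2 + eta ^ 2) : ℝ) : ℂ) ^ 2 = S.l * S.L := by
    rw [S.l_mul_L, ← Complex.ofReal_pow, Real.sq_sqrt hr.le]; rfl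
  have h1 : (‖nu11‖ : ℂ) ≠ 0 := by simpa using hnu11
  have h2 : (‖nu21‖ : ℂ) ≠ 0 := by simpa using hnu21
  have hs0 : ((Real.sqrt (xi ^ 2 + eta ^ 2) : ℝ) : ℂ) ≠ 0 := by
    intro h
    rw [h] at hs
    exact mul_ne_zero hl0 hL0 (by simpa using hs.symm)
  have hW : Complex.exp (varpi xi eta nu11 nu21)
      = S.l * ‖nu11‖ / (Real.sqrt (xi ^ 2 + eta ^ 2) * ‖nu21‖) := by
    rw [varpi, Complex.exp_log, hl]
    rw [← hl]
    exact div_ne_zero (mul_ne_zero hl0 h1) (mul_ne_zero hs0 h2)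
  have hWne : Complex.exp (varpi xi eta nu11 nu21) ≠ 0 := Complex.exp_ne_zero _
  have hW2 : Complex.exp (varpi xi eta nu11 nu21) ^ 2 * (S.L * (‖nu21‖ : ℂ) ^ 2)
      = S.l * (‖nu11‖ : ℂ) ^ 2 := by
    rw [hW, div_pow, mul_pow _ (‖nu21‖ : ℂ), hs]
    field_simp
  have hA := atTime_A (eps := eps) hxi heta (div_ne_zero hnu21 hnu11) x t
  have hB := atTime_B (eps := eps) hxi heta (div_ne_zero hnu21 hnu11) x t
  have hN := atTime_N (eps := eps) hxi heta (div_ne_zero hnu21 hnu11) x t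
  rw [← hS] at hA hB hN
  have hBA : S.A x * S.B x * ‖nu11‖ ^ 2 = ‖nu21‖ ^ 2 := by
    have := norm_ne_zero_iff.2 hnu11
    rw [hA, hB, Real.exp_neg, norm_div]
    have := (Real.exp_pos (2 * thetaR xi eta eps x t)).ne'
    field_simp
  have hBA' : (S.A x : ℂ) * S.B x * (‖nu11‖ : ℂ) ^ 2 = (‖nu21‖ : ℂ) ^ 2 := by
    exact_mod_cast hBA
  have hAe : Complex.exp (2 * thetaR xi eta eps x t) = S.A x := by
    rw [hA]; push_cast; rfl
  have hA0 : (S.A x : ℂ) ≠ 0 := by exact_mod_cast (S.A_pos x).ne'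
  -- Only the square of `exp ϖ₁` enters, which is free of the square root.
  have hsech : Complex.exp (varpi xi eta nu11 nu21)
      * sech (2 * thetaR xi eta eps x t + varpi xi eta nu11 nu21) = 2 * S.l / S.D x := by
    rw [sech, Complex.cosh, Complex.exp_neg, Complex.exp_add, hAe]
    generalize Complex.exp (varpi xi eta nu11 nu21) = W at hW2 hWne ⊢
    have h3 : W ^ 2 * S.D x = S.l * (S.A x * W ^ 2 + (S.A x : ℂ)⁻¹) := by
      have h4 : W ^ 2 * S.L * S.B x = S.l * (S.A x : ℂ)⁻¹ := by
        field_simp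
        have h5 : (‖nu11‖ : ℂ) ^ 2 ≠ 0 := pow_ne_zero 2 h1
        apply mul_right_cancel₀ h5
        linear_combination (W ^ 2 * S.L) * hBA' + hW2
      rw [D]
      linear_combination h4
    have h6 : S.A x * W ^ 2 + (S.A x : ℂ)⁻¹ ≠ 0 := by
      intro h
      rw [h, mul_zero] at h3
      exact mul_ne_zero (pow_ne_zero 2 hWne) hD0 h3
    have h7 : (S.A x * W + (S.A x * W)⁻¹) / 2 = (S.A x * W ^ 2 + (S.A x : ℂ)⁻¹) / (2 * W) := by
      field_simp
    rw [h7, inv_div, ← mul_div_assoc, div_eq_div_iff h6 hD0]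
    linear_combination 2 * h3
  have hn1 : (starRingEnd ℂ) nu11 ≠ 0 := by simpa using hnu11
  have hE : oneSoliton xi eta eps nu11 nu21 x t
      = 2 * Complex.I * xi * eta * (starRingEnd ℂ) nu21
        * Complex.exp (2 * Complex.I * thetaI xi eta eps x t)
        / (S.l ^ 2 * S.L * (starRingEnd ℂ) nu11)
        * (Complex.exp (varpi xi eta nu11 nu21)
          * sech (2 * thetaR xi eta eps x t + varpi xi eta nu11 nu21)) := by
    rw [oneSoliton, Complex.exp_add, hl, hL]
    ring
  rw [hE, hsech, q, hN, S.l_sq_sub, map_div₀]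
  have e1 : (S.xi : ℂ) = xi := rfl
  have e2 : (S.eta : ℂ) = eta := rfl
  rw [e1, e2]
  field_simp
  ring

lemma contDiff_q :
    ContDiff ℝ (⊤ : ℕ∞) fun p : ℝ × ℝ => (atTime eps hxi heta hc p.2).q p.1 := by
  have hof : ContDiff ℝ (⊤ : ℕ∞) (fun r : ℝ => (r : ℂ)) := Complex.ofRealCLM.contDiff
  have hR : ContDiff ℝ (⊤ : ℕ∞) fun p : ℝ × ℝ => thetaR xi eta eps p.1 p.2 := by
    unfold thetaR; fun_prop
  have hI : ContDiff ℝ (⊤ : ℕ∞) fun p : ℝ × ℝ => thetaI xi eta eps p.1 p.2 := by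
    unfold thetaI; fun_prop
  have hA : ContDiff ℝ (⊤ : ℕ∞) fun p : ℝ × ℝ => ((atTime eps hxi heta hc p.2).A p.1 : ℂ) := by
    simp only [atTime_A]
    exact hof.comp (contDiff_const.mul hR).exp
  have hB : ContDiff ℝ (⊤ : ℕ∞) fun p : ℝ × ℝ => ((atTime eps hxi heta hc p.2).B p.1 : ℂ) := by
    simp only [atTime_B]
    exact hof.comp (contDiff_const.mul (contDiff_const.mul hR).neg.exp)
  have hN : ContDiff ℝ (⊤ : ℕ∞) fun p : ℝ × ℝ => (atTime eps hxi heta hc p.2).N p.1 := by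
    simp only [atTime_N]
    exact contDiff_const.mul (contDiff_const.mul (hof.comp hI)).cexp
  have hl (t : ℝ) : (atTime eps hxi heta hc t).l = (atTime eps hxi heta hc 0).l := rfl
  have hL (t : ℝ) : (atTime eps hxi heta hc t).L = (atTime eps hxi heta hc 0).L := rfl
  have hD : ContDiff ℝ (⊤ : ℕ∞) fun p : ℝ × ℝ => (atTime eps hxi heta hc p.2).D p.1 := by
    simp only [D, hl, hL]
    exact (contDiff_const.mul hA).add (contDiff_const.mul hB)
  simp only [q, hl, hL, div_eq_mul_inv]
  refine (contDiff_const.mul hN).mul (ContDiff.inv (contDiff_const.mul hD) fun p => ?_)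
  exact mul_ne_zero (mul_ne_zero (Soliton.l_ne _) (Soliton.L_ne _)) (Soliton.D_ne _ _)

lemma weight_l (t : ℝ) :
    weight eps (atTime eps hxi heta hc t).l
      = (((2 : ℝ) ^ (2 * eps) * (xi ^ 2 + eta ^ 2) ^ (2 * eps) : ℝ) : ℂ) := by
  have hr : 0 < xi ^ 2 + eta ^ 2 := by positivity
  set S := atTime eps hxi heta hc t with hS
  have h : ‖S.l ^ 2‖ = xi ^ 2 + eta ^ 2 := by
    rw [norm_pow, ← Complex.normSq_eq_norm_sq, Complex.normSq_apply, S.l_re, S.l_im]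
    change xi * xi + eta * eta = _
    ring
  rw [weight, norm_mul, h, Complex.norm_ofNat, Real.mul_rpow (by norm_num) hr.le]

lemma hasDerivAt_thetaR (hr : 0 < xi ^ 2 + eta ^ 2) (x t : ℝ) :
    HasDerivAt (fun τ => 2 * thetaR xi eta eps x τ)
      ((2 : ℝ) ^ (2 * eps) * (xi ^ 2 + eta ^ 2) ^ (2 * eps) * xi * eta
        / (xi ^ 2 + eta ^ 2) ^ 2) t := by
  have h := (((hasDerivAt_id t).const_mul ((2 : ℝ) ^ (2 * eps - 1) * xi * eta
    * (xi ^ 2 + eta ^ 2) ^ (2 * eps - 2))).const_add (2 * xi * eta * x)).const_mul 2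
  refine h.congr_deriv ?_
  rw [Real.rpow_sub (by norm_num), Real.rpow_sub hr, Real.rpow_one, Real.rpow_two]
  field_simp

lemma hasDerivAt_thetaI (hr : 0 < xi ^ 2 + eta ^ 2) (x t : ℝ) :
    HasDerivAt (fun τ => 2 * thetaI xi eta eps x τ)
      ((2 : ℝ) ^ (2 * eps) * (xi ^ 2 + eta ^ 2) ^ (2 * eps) * (xi ^ 2 - eta ^ 2)
        / (2 * (xi ^ 2 + eta ^ 2) ^ 2)) t := by
  have h := (((hasDerivAt_id t).const_mul ((4 : ℝ) ^ (eps - 1) * (xi ^ 2 - eta ^ 2)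
    * (xi ^ 2 + eta ^ 2) ^ (2 * eps - 2))).const_add (-(xi ^ 2 - eta ^ 2) * x)).const_mul 2
  refine h.congr_deriv ?_
  have h4 : (4 : ℝ) ^ eps = 2 ^ (2 * eps) := by
    rw [Real.rpow_mul (by norm_num)]; norm_num
  rw [Real.rpow_sub (by norm_num), Real.rpow_sub hr, Real.rpow_one, Real.rpow_two, h4]
  field_simp
  norm_num

/-- The evolution equation, with the values of the two contour integrals on the right. -/
lemma hasDerivAt_u (x t : ℝ) {S : Soliton} (hS : S = atTime eps hxi heta hc t) :
    HasDerivAt (fun τ => (atTime eps hxi heta hc τ).u x)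
      (-(1 / (4 * (Real.pi : ℂ))) * (4 * Real.pi * weight eps S.l * (S.l ^ 2 - S.L ^ 2)
          * S.B x * S.N x / (S.l ^ 2 * S.D x ^ 3)
          * ((S.l ^ 2 - 2 * S.L ^ 2) * S.A x - S.l * S.L * S.B x))
        + 1 / (4 * (Real.pi : ℂ)) * -(4 * Real.pi * weight eps S.l * (S.l ^ 2 - S.L ^ 2)
          * S.A x * S.N x / (S.L ^ 2 * S.D x ^ 3)
          * ((S.L ^ 2 - 2 * S.l ^ 2) * S.B x - S.l * S.L * S.A x))) t := by
  have hl := S.l_ne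
  have hL := S.L_ne
  have hD := S.D_ne x
  have hpi : (Real.pi : ℂ) ≠ 0 := by exact_mod_cast Real.pi_ne_zero
  set w := weight eps S.l with hw
  have hw' : w = (((2 : ℝ) ^ (2 * eps) * (xi ^ 2 + eta ^ 2) ^ (2 * eps) : ℝ) : ℂ) := by
    rw [hw, hS, weight_l]
  have exi : S.xi = xi := by rw [hS]; rfl
  have eeta : S.eta = eta := by rw [hS]; rfl
  have hlL := S.l_mul_L
  have hsub := S.l_sq_sub
  have hadd := S.l_sq_add
  rw [exi, eeta] at hlL hsub hadd
  have hr : 0 < xi ^ 2 + eta ^ 2 := by positivity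
  have hr0 : (xi : ℂ) ^ 2 + (eta : ℂ) ^ 2 ≠ 0 := by
    have := mul_ne_zero hl hL
    rw [hlL] at this
    exact_mod_cast this
  -- The rate at which `A` grows and `B` decays.
  set ρ : ℂ := -Complex.I * w * (S.l ^ 2 - S.L ^ 2) / (4 * (S.l * S.L) ^ 2) with hρ
  have hρ' : ρ = (((2 : ℝ) ^ (2 * eps) * (xi ^ 2 + eta ^ 2) ^ (2 * eps) * xi * eta
        / (xi ^ 2 + eta ^ 2) ^ 2 : ℝ) : ℂ) := by
    rw [hρ, hlL, hsub, hw']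
    push_cast
    field_simp
    linear_combination (-(((2 : ℝ) ^ (2 * eps) : ℝ) : ℂ) * (((xi ^ 2 + eta ^ 2) ^ (2 * eps) : ℝ) : ℂ)
      * xi * eta) * Complex.I_sq
  have hA : HasDerivAt (fun τ => ((atTime eps hxi heta hc τ).A x : ℂ)) (ρ * S.A x) t := by
    have := (hasDerivAt_thetaR hr x t (eps := eps)).exp.ofReal_comp
    simp only [← atTime_A hxi heta hc] at this
    refine this.congr_deriv ?_
    rw [hρ', hS]
    push_cast
    ring
  have hB : HasDerivAt (fun τ => ((atTime eps hxi heta hc τ).B x : ℂ)) (-ρ * S.B x) t := by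
    have := ((hasDerivAt_thetaR hr x t (eps := eps)).neg.exp.const_mul
      (‖c‖ ^ 2)).ofReal_comp
    simp only [Pi.neg_apply] at this
    rw [← mul_assoc] at this
    simp only [← atTime_B hxi heta hc] at this
    refine this.congr_deriv ?_
    rw [hρ', hS]
    push_cast
    ring
  have hN : HasDerivAt (fun τ => (atTime eps hxi heta hc τ).N x)
      (Complex.I * w * (S.l ^ 2 + S.L ^ 2) / (4 * (S.l * S.L) ^ 2) * S.N x) t := by
    have := (((hasDerivAt_thetaI hr x t (eps := eps)).ofReal_comp.const_mul
      Complex.I).cexp).const_mul ((starRingEnd ℂ) c)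
    have e : ∀ τ : ℝ, Complex.I * ((2 * thetaI xi eta eps x τ : ℝ) : ℂ)
        = 2 * Complex.I * thetaI xi eta eps x τ := by
      intro τ; push_cast; ring
    simp only [e] at this
    rw [← mul_assoc] at this
    simp only [← atTime_N hxi heta hc] at this
    refine this.congr_deriv ?_
    rw [hlL, hadd, hw', hS]
    push_cast
    field_simp
    norm_num
  have hl' (τ : ℝ) : (atTime eps hxi heta hc τ).l = S.l := by rw [hS]; rfl
  have hL' (τ : ℝ) : (atTime eps hxi heta hc τ).L = S.L := by rw [hS]; rfl
  have hDt : HasDerivAt (fun τ => (atTime eps hxi heta hc τ).D x)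
      (S.l * (ρ * S.A x) + S.L * (-ρ * S.B x)) t := by
    simp only [D, hl', hL']
    exact (hA.const_mul S.l).add (hB.const_mul S.L)
  have hEt : HasDerivAt (fun τ => (atTime eps hxi heta hc τ).E x)
      (S.L * (ρ * S.A x) + S.l * (-ρ * S.B x)) t := by
    simp only [E, hl', hL']
    exact (hA.const_mul S.L).add (hB.const_mul S.l)
  have hD' : (atTime eps hxi heta hc t).D x ≠ 0 := Soliton.D_ne _ _
  have hu := ((hN.const_mul (-2 * Complex.I * (S.l ^ 2 - S.L ^ 2))).mul hEt).div (hDt.pow 2)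
    (pow_ne_zero 2 hD')
  have hfun : (fun τ => (atTime eps hxi heta hc τ).u x) = fun τ =>
      -2 * Complex.I * (S.l ^ 2 - S.L ^ 2) * (atTime eps hxi heta hc τ).N x
        * (atTime eps hxi heta hc τ).E x / (atTime eps hxi heta hc τ).D x ^ 2 := by
    funext τ
    rw [u, hl', hL']
  rw [hfun]
  refine hu.congr_deriv ?_
  simp only [Pi.mul_apply, Pi.pow_apply, ← hS, hρ]
  push_cast
  field_simp
  rw [Complex.I_sq]
  simp only [D, E]
  ring

end Evolution

end

end FracFL

theorem mainTheorem1 (xi eta eps : ℝ) (hxi : 0 < xi) (heta : 0 < eta)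
    (heps0 : 0 ≤ eps) (heps1 : eps < 1) (nu11 nu21 : ℂ) (hnu11 : nu11 ≠ 0) (hnu21 : nu21 ≠ 0) :
    FracFL.IsSolution eps (FracFL.oneSoliton xi eta eps nu11 nu21) := by
  have hq (t : ℝ) : (fun x => FracFL.oneSoliton xi eta eps nu11 nu21 x t)
      = (FracFL.Soliton.atTime eps hxi heta (div_ne_zero hnu21 hnu11) t).q :=
    funext fun x => FracFL.oneSoliton_eq hxi heta hnu11 hnu21 x t
  refine ⟨?_, fun t => ?_⟩
  · simp only [FracFL.oneSoliton_eq hxi heta hnu11 hnu21]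
    exact FracFL.contDiff_q hxi heta (div_ne_zero hnu21 hnu11)
  · simp only [hq, FracFL.Soliton.deriv_q]
    refine ⟨FracFL.Soliton.isDecaying _, FracFL.Soliton.jost _, FracFL.Soliton.s11 _,
      FracFL.Soliton.s22 _, _, _, FracFL.Soliton.isJost _, FracFL.Soliton.isScattering _,
      FracFL.Soliton.isDiscreteSpectrum _, fun x => ⟨_, _,
      FracFL.Soliton.hasGammaIntegral_kernelPlus _ eps x,
      FracFL.Soliton.hasGammaIntegral_kernelMinus _ eps x,
      FracFL.hasDerivAt_u hxi heta (div_ne_zero hnu21 hnu11) x t rfl⟩⟩
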